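/- Setting. Let $A$ be a positive self-adjoint operator on the real Hilbert space $H=L^2(\mathbb R,dt)$ with $\inf\sigma(A)>1$ and Hilbert–Schmidt inverse. Let $E=\bigcap_{p}\mathrm{dom}(A^p)$ with the norms $|\xi|_p=|A^p\xi|_0$, let $E^*$ be its topological dual and $E_{\mathbb C}$ its complexification; let $E_{\mathbb C}^{\otimes n}$ be the completed tensor power with the norms $|f|_p=|(A^{p})^{\otimes n}f|_0$, and let the index "sym" denote symmetric elements. Let $\tau\in(E_{\mathbb C}^{\otimes 2})^*$ be the trace, $\langle\tau,\xi\otimes\eta\rangle=\langle\xi,\eta\rangle$, and for $x\in E^*$ let $$:x^{\otimes n}:\;=\sum_{k=0}^{\lfloor n/2\rfloor}\binom{n}{2k}(2k-1)!!\,(-1)^k\,x^{\otimes(n-2k)}\,\widehat\otimes\,\tau^{\otimes k}$$ be the Wick ordering of $x^{\otimes n}$. For $0\le\beta<1$ let $(E)_\beta$ be the space of all sequences $\varphi\sim(f_n)_{n\ge0}$, $f_n\in(E_{\mathbb C}^{\otimes n})_{sym}$, with $|\varphi|_{p,\beta}^2=\sum_n (n!)^{1+\beta}|f_n|_p^2<\infty$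 for all $p$, topologized by these norms; $\varphi$ is regarded as the function $\varphi(x)=\sum_n\langle:x^{\otimes n}:,f_n\rangle$ on $E^*$. Write $(E)=(E)_0$. For $\kappa\in(E_{\mathbb C}^{\otimes r})^*_{sym}$ let $$\Xi_{0,r}(\kappa)\varphi=\sum_{n=0}^\infty\frac{(n+r)!}{n!}\langle:x^{\otimes n}:,\kappa\otimes_r f_{n+r}\rangle ,$$ where $\otimes_r$ is the contraction of $r$ tensor factors, put $\Delta_G=\Xi_{0,2}(\tau)$, and for $x\in E^*$, $r\ge1$ let $$:x^{\otimes n}:_{\kappa}\;=\sum_{k=0}^{\lfloor n/r\rfloor}\frac{n!}{(n-rk)!\,k!}\Big(-\frac12\Big)^k x^{\otimes(n-rk)}\,\widehat\otimes\,\kappa^{\widehat\otimes k}.$$ For $\zeta\in E_{\mathbb C}$ let $\Phi_\zeta\sim(\zeta^{\otimes n}/n!)_n$. Proposition. (i) Let $r\ge1$, $\kappa_{0,r}\in(E_{\mathbb C}^{\otimes r})^*_{sym}$ and $\frac{\max(0,r-2)}{r}\le\beta<1$. Then $\Xi_{0,r}(\kappa_{0,r})$ is a continuous linear operator on $(E)_\beta$,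 the series $\exp(-\frac12\Xi_{0,r}(\kappa_{0,r}))=\sum_n\frac1{n!}(-\frac12\Xi_{0,r}(\kappa_{0,r}))^n$ converges in $L((E)_\beta,(E)_\beta)$ for the topology of uniform convergence on bounded sets, and for all $m\ge0$ and $f_m\in(E_{\mathbb C}^{\otimes m})_{sym}$ the function $x\mapsto\langle x^{\otimes m},f_m\rangle$ is the function of exactly one element of $(E)_\beta$ and $$\exp\!\big(-\tfrac12\Xi_{0,r}(\kappa_{0,r})\big)\langle x^{\otimes m},f_m\rangle=\langle:x^{\otimes m}:_{\kappa_{0,r}},f_m\rangle .$$ (ii) For $r=2$ and $\kappa=\tau$ this is ordinary Wick ordering: $:x^{\otimes m}:_\tau\;=\;:x^{\otimes m}:$ for all $x\in E^*$, $m\ge0$; moreover $e^{\langle\cdot,\zeta\rangle}\in(E)$ for all $\zeta\in E_{\mathbb C}$, there is exactly one $\Theta\in L((E),(E))$ with $\Theta(e^{\langle\cdot,\zeta\rangle})=\Phi_\zeta$ for all $\zeta\in E_{\mathbb C}$ (the renormalization operator), one has $\Theta=\exp(-\frac12\Delta_G)$, and $\Theta\langle x^{\otimes m},f_m\rangle=\langle:x^{\otimes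 m}:,f_m\rangle$ for all $f_m\in(E_{\mathbb C}^{\otimes m})_{sym}$. -/

import Mathlib

open MeasureTheory
open scoped NNReal

noncomputable section

namespace WhiteNoise

/-! ### The operator `A` on the real Hilbert space `L²(ℝ, dt)` -/

/-- The real Hilbert space `H = L²(ℝ, dt)`. -/
abbrev RealL2 : Type := Lp ℝ 2 (volume : Measure ℝ)

/-- The bounded operator `R` is the two-sided inverse of `A - z`, with values in the domain. -/
structure IsResolventAt (A : RealL2 →ₗ.[ℝ] RealL2) (z : ℝ) (R : RealL2 →L[ℝ] RealL2) : Prop where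
  mem_domain : ∀ h, R h ∈ A.domain
  right_inv : ∀ h, A ⟨R h, mem_domain h⟩ - z • R h = h
  left_inv : ∀ ξ : A.domain, R (A ξ - z • (ξ : RealL2)) = ξ

/-- The (real) spectrum of an unbounded operator; for a self-adjoint operator the whole spectrum
of its complexification is real. -/
def spectrumOf (A : RealL2 →ₗ.[ℝ] RealL2) : Set ℝ :=
  {z | ¬ ∃ R : RealL2 →L[ℝ] RealL2, IsResolventAt A z R}

/-- `A` is a positive self-adjoint operator on `L²(ℝ, dt)` with `inf σ(A) > 1` and with a
Hilbert-Schmidt inverse. (Self-adjointness contains that the domain is dense.) -/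
structure IsWhiteNoiseOperator (A : RealL2 →ₗ.[ℝ] RealL2) : Prop where
  selfAdjoint : IsSelfAdjoint A
  positive : ∀ ξ : A.domain, 0 ≤ inner ℝ (A ξ) (ξ : RealL2)
  one_lt_inf_spectrum : ∃ c : ℝ, 1 < c ∧ ∀ z ∈ spectrumOf A, c ≤ z
  hilbertSchmidt_inverse : ∃ R : RealL2 →L[ℝ] RealL2, IsResolventAt A 0 R ∧
    ∃ b : HilbertBasis ℕ ℝ RealL2, Summable fun i => ‖R (b i)‖ ^ 2

/-- An orthonormal basis of `L²(ℝ, dt)` made of eigenvectors of `A`. It serves to write down the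
powers `A ^ p` and the tensor powers in coordinates. -/
structure Eigenbasis (A : RealL2 →ₗ.[ℝ] RealL2) where
  ι : Type
  e : HilbertBasis ι ℝ RealL2
  lam : ι → ℝ
  mem_domain : ∀ j, e j ∈ A.domain
  apply_eq : ∀ j, A ⟨e j, mem_domain j⟩ = lam j • e j
  one_lt : ∃ c : ℝ, 1 < c ∧ ∀ j, c ≤ lam j
  summable_inv_sq : Summable fun j => (lam j ^ 2)⁻¹

/-! ### Weighted sequence spaces -/

section Koethe

variable (𝕜 : Type) [RCLike 𝕜] {α : Type} (w : ℕ → α → ℝ)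

theorem memlp_two_iff {f : α → 𝕜} (v : α → ℝ) :
    Memℓp (fun a => (v a : 𝕜) * f a) 2 ↔ Summable fun a => (v a * ‖f a‖) ^ 2 := by
  rw [memℓp_gen_iff (by norm_num)]
  refine summable_congr fun a => ?_
  simp [mul_pow]

/-- Families `f` with `∑ₐ (w p a ‖f a‖)² < ∞` for all `p`. -/
def koetheSubmodule : Submodule 𝕜 (α → 𝕜) where
  carrier := {f | ∀ p, Summable fun a => (w p a * ‖f a‖) ^ 2}
  add_mem' := by
    intro f g hf hg p
    rw [← memlp_two_iff]
    have := ((memlp_two_iff 𝕜 (w p)).2 (hf p)).add ((memlp_two_iff 𝕜 (w p)).2 (hg p))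
    convert this using 1
    funext a
    simp [mul_add]
  zero_mem' := by
    intro p
    simp
  smul_mem' := by
    intro c f hf p
    rw [← memlp_two_iff]
    have := ((memlp_two_iff 𝕜 (w p)).2 (hf p)).const_smul c
    convert this using 1
    funext a
    simp [mul_left_comm]

/-- The space of all families `f` with `∑ₐ (w p a ‖f a‖)² < ∞` for all `p`, a countably Hilbert
space for the norms `(∑ₐ (w p a ‖f a‖)²)^½`. (A type of its own: the subtype of `α → 𝕜` would carry
the topology of pointwise convergence.) -/
def Koethe : Type := koetheSubmodule 𝕜 w

instance : AddCommGroup (Koethe 𝕜 w) := inferInstanceAs (AddCommGroup (koetheSubmodule 𝕜 w))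

instance : Module 𝕜 (Koethe 𝕜 w) := inferInstanceAs (Module 𝕜 (koetheSubmodule 𝕜 w))

instance : FunLike (Koethe 𝕜 w) α 𝕜 where
  coe f := Subtype.val (p := fun f => f ∈ koetheSubmodule 𝕜 w) f
  coe_injective := Subtype.val_injective

variable {𝕜 w}

/-- A family with finite norms, as an element of the space. -/
def Koethe.mk (f : α → 𝕜) (hf : ∀ p, Summable fun a => (w p a * ‖f a‖) ^ 2) : Koethe 𝕜 w :=
  (⟨f, hf⟩ : koetheSubmodule 𝕜 w)

@[simp] theorem Koethe.mk_apply (f : α → 𝕜) (hf : ∀ p, Summable fun a => (w p a * ‖f a‖) ^ 2)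
    (a : α) : Koethe.mk (w := w) f hf a = f a := rfl

theorem Koethe.summable (f : Koethe 𝕜 w) (p : ℕ) : Summable fun a => (w p a * ‖f a‖) ^ 2 :=
  Subtype.property (p := fun f => f ∈ koetheSubmodule 𝕜 w) f p

@[ext] theorem Koethe.ext {f g : Koethe 𝕜 w} (h : ∀ a, f a = g a) : f = g := DFunLike.ext f g h

@[simp] theorem Koethe.add_apply (f g : Koethe 𝕜 w) (a : α) : (f + g) a = f a + g a := rfl

@[simp] theorem Koethe.smul_apply (c : 𝕜) (f : Koethe 𝕜 w) (a : α) : (c • f) a = c * f a := rfl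

variable (𝕜 w)

/-- The weighted family as an element of `ℓ²`. -/
def Koethe.toLp (p : ℕ) : Koethe 𝕜 w →ₗ[𝕜] lp (fun _ : α => 𝕜) 2 where
  toFun f := ⟨fun a => (w p a : 𝕜) * f a, (memlp_two_iff 𝕜 (w p)).2 (f.summable p)⟩
  map_add' f g := by
    ext a
    exact mul_add _ _ _
  map_smul' c f := by
    ext a
    simp [mul_left_comm]

/-- The norms `|f|_p = (∑ₐ (w p a ‖f a‖)²)^½`. -/
def Koethe.norms : SeminormFamily 𝕜 (Koethe 𝕜 w) ℕ := fun p =>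
  (normSeminorm 𝕜 (lp (fun _ : α => 𝕜) 2)).comp (Koethe.toLp 𝕜 w p)

instance : TopologicalSpace (Koethe 𝕜 w) := (Koethe.norms 𝕜 w).moduleFilterBasis.topology

theorem Koethe.withSeminorms : WithSeminorms (Koethe.norms 𝕜 w) := ⟨rfl⟩

instance : IsTopologicalAddGroup (Koethe 𝕜 w) := (Koethe.withSeminorms 𝕜 w).topologicalAddGroup

instance : ContinuousSMul 𝕜 (Koethe 𝕜 w) := (Koethe.withSeminorms 𝕜 w).continuousSMul

variable {𝕜 w}

theorem Koethe.norms_sq (p : ℕ) (f : Koethe 𝕜 w) :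
    Koethe.norms 𝕜 w p f ^ 2 = ∑' a, (w p a * ‖f a‖) ^ 2 := by
  have h := lp.norm_rpow_eq_tsum (p := 2) (by norm_num) (Koethe.toLp 𝕜 w p f)
  have h' : Koethe.norms 𝕜 w p f = ‖Koethe.toLp 𝕜 w p f‖ := rfl
  rw [h']
  simp only [ENNReal.toReal_ofNat, Real.rpow_ofNat] at h
  rw [h]
  refine tsum_congr fun a => ?_
  simp [Koethe.toLp, mul_pow]

theorem Koethe.norms_mono (hw : ∀ p a, 0 ≤ w p a) (hm : ∀ p q, p ≤ q → ∀ a, w p a ≤ w q a)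
    {p q : ℕ} (hpq : p ≤ q) : Koethe.norms 𝕜 w p ≤ Koethe.norms 𝕜 w q := by
  intro f
  refine (pow_le_pow_iff_left₀ (apply_nonneg _ _) (apply_nonneg _ _) two_ne_zero).1 ?_
  rw [Koethe.norms_sq, Koethe.norms_sq]
  refine (f.summable p).tsum_le_tsum (fun a => ?_) (f.summable q)
  have := hw p a
  have := hm p q hpq a
  gcongr

theorem exists_bound {V : Type} [AddCommGroup V] [Module 𝕜 V] [TopologicalSpace V]
    {N : SeminormFamily 𝕜 V ℕ} (hN : WithSeminorms N) (hm : Monotone N) (κ : V →L[𝕜] 𝕜) :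
    ∃ (q : ℕ) (C : ℝ), 0 ≤ C ∧ ∀ f, ‖κ f‖ ≤ C * N q f := by
  obtain ⟨s, C, -, h⟩ := Seminorm.bound_of_continuous hN
    ((normSeminorm 𝕜 𝕜).comp (κ : V →ₗ[𝕜] 𝕜)) (continuous_norm.comp κ.continuous)
  refine ⟨s.sup id, C, C.2, fun f => ?_⟩
  have h1 : s.sup N ≤ N (s.sup id) := Finset.sup_le fun i hi => hm (Finset.le_sup (f := id) hi)
  exact (h f).trans (mul_le_mul_of_nonneg_left (h1 f) C.2)

theorem Koethe.continuous_of_bound {β : Type} {v : ℕ → β → ℝ}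
    (T : Koethe 𝕜 w →ₗ[𝕜] Koethe 𝕜 v)
    (h : ∀ p, ∃ (q : ℕ) (C : ℝ), 0 ≤ C ∧
      ∀ f, Koethe.norms 𝕜 v p (T f) ≤ C * Koethe.norms 𝕜 w q f) : Continuous T := by
  refine WithSeminorms.continuous_of_isBounded (Koethe.withSeminorms 𝕜 w)
    (Koethe.withSeminorms 𝕜 v) T ?_
  intro p
  obtain ⟨q, C, hC, h⟩ := h p
  refine ⟨{q}, ⟨C, hC⟩, fun f => ?_⟩
  rw [Finset.sup_singleton]
  exact h f

theorem summable_mul_and_le {a b : α → ℝ} (ha : ∀ i, 0 ≤ a i) (hb : ∀ i, 0 ≤ b i)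
    (hsa : Summable fun i => a i ^ 2) (hsb : Summable fun i => b i ^ 2) :
    Summable (fun i => a i * b i) ∧
      ∑' i, a i * b i ≤ √(∑' i, a i ^ 2) * √(∑' i, b i ^ 2) := by
  have := Real.summable_and_inner_le_Lp_mul_Lq_tsum_of_nonneg
    (Real.HolderConjugate.two_two) ha hb (by simpa using hsa) (by simpa using hsb)
  simpa [Real.sqrt_eq_rpow] using this

theorem Koethe.pairing_aux {c : α → 𝕜} {p : ℕ} (hw : ∀ a, 0 < w p a)
    (hc : Summable fun a => ((w p a)⁻¹ * ‖c a‖) ^ 2) (f : Koethe 𝕜 w) :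
    Summable (fun a => c a * f a) ∧
      ‖∑' a, c a * f a‖ ≤ √(∑' a, ((w p a)⁻¹ * ‖c a‖) ^ 2) * Koethe.norms 𝕜 w p f := by
  have hn : ∀ a, ‖c a * f a‖ = ((w p a)⁻¹ * ‖c a‖) * (w p a * ‖f a‖) := fun a => by
    have := (hw a).ne'
    rw [norm_mul]
    field_simp
  obtain ⟨h1, h2⟩ := summable_mul_and_le
    (a := fun a => (w p a)⁻¹ * ‖c a‖) (b := fun a => w p a * ‖f a‖)
    (fun a => by have := hw a; positivity) (fun a => by have := hw a; positivity) hc (f.summable p)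
  have h3 : Summable fun a => ‖c a * f a‖ := h1.congr fun a => (hn a).symm
  refine ⟨h3.of_norm, (norm_tsum_le_tsum_norm h3).trans ?_⟩
  rw [← Koethe.norms_sq, Real.sqrt_sq (apply_nonneg _ _)] at h2
  exact (tsum_congr hn).le.trans h2

/-- The continuous functional `f ↦ ∑ₐ c a f a` with coefficients `c` in some dual weighted `ℓ²`. -/
def Koethe.pairing (c : α → 𝕜)
    (hc : ∃ p, (∀ a, 0 < w p a) ∧ Summable fun a => ((w p a)⁻¹ * ‖c a‖) ^ 2) :
    Koethe 𝕜 w →L[𝕜] 𝕜 where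
  toFun f := ∑' a, c a * f a
  map_add' f g := by
    obtain ⟨p, hw, hc⟩ := hc
    rw [← (Koethe.pairing_aux hw hc f).1.tsum_add (Koethe.pairing_aux hw hc g).1]
    exact tsum_congr fun a => mul_add _ _ _
  map_smul' z f := by
    simp only [Koethe.smul_apply, RingHom.id_apply, smul_eq_mul, ← tsum_mul_left]
    exact tsum_congr fun a => mul_left_comm _ _ _
  cont := by
    obtain ⟨p, hw, hc⟩ := hc
    let T : Koethe 𝕜 w →ₗ[𝕜] 𝕜 :=
      { toFun := fun f => ∑' a, c a * f a
        map_add' := fun f g => by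
          rw [← (Koethe.pairing_aux hw hc f).1.tsum_add (Koethe.pairing_aux hw hc g).1]
          exact tsum_congr fun a => mul_add _ _ _
        map_smul' := fun z f => by
          simp only [Koethe.smul_apply, RingHom.id_apply, smul_eq_mul, ← tsum_mul_left]
          exact tsum_congr fun a => mul_left_comm _ _ _ }
    refine WithSeminorms.continuous_normedSpace_rng 𝕜 (Koethe.withSeminorms 𝕜 w) T
      ⟨{p}, ⟨_, Real.sqrt_nonneg (∑' a, ((w p a)⁻¹ * ‖c a‖) ^ 2)⟩, fun f => ?_⟩
    rw [Finset.sup_singleton]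
    exact (Koethe.pairing_aux hw hc f).2

end Koethe

theorem summable_pi_prod {ι : Type} {g : ι → ℝ} (h0 : ∀ j, 0 ≤ g j) (hg : Summable g) (n : ℕ) :
    Summable fun J : Fin n → ι => ∏ i, g (J i) := by
  induction n with
  | zero => exact Summable.of_finite
  | succ n ih =>
    rw [← (Fin.consEquiv fun _ : Fin (n + 1) => ι).summable_iff]
    refine (hg.mul_of_nonneg ih h0 fun J => Finset.prod_nonneg fun i _ => h0 _).congr fun x => ?_
    simp [Fin.prod_univ_succ, Fin.consEquiv]

/-! ### The spaces `E`, `E*` and the tensor powers of `E_ℂ` -/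

namespace Eigenbasis

variable {A : RealL2 →ₗ.[ℝ] RealL2} (S : Eigenbasis A)

theorem one_le (j : S.ι) : 1 ≤ S.lam j := by
  obtain ⟨c, hc, h⟩ := S.one_lt
  exact hc.le.trans (h j)

/-- `E = ⋂_p dom(A ^ p) = {ξ ∈ L²(ℝ, dt) : |A ^ p ξ|₀² = ∑ⱼ (λⱼ ^ p |⟨eⱼ, ξ⟩|)² < ∞ for all p}`. -/
def testSubmodule : Submodule ℝ RealL2 :=
  (koetheSubmodule ℝ fun p j => S.lam j ^ p).comap
    ({ toFun := fun ξ j => inner ℝ (S.e j) ξ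
       map_add' := fun _ _ => funext fun _ => inner_add_right _ _ _
       map_smul' := fun _ _ => funext fun _ => real_inner_smul_right _ _ _ } :
      RealL2 →ₗ[ℝ] S.ι → ℝ)

/-- The real nuclear space `E`, with the topology given by the norms `|ξ|_p = |A ^ p ξ|₀`. -/
def TestSpace : Type := S.testSubmodule

instance : AddCommGroup S.TestSpace := inferInstanceAs (AddCommGroup S.testSubmodule)

instance : Module ℝ S.TestSpace := inferInstanceAs (Module ℝ S.testSubmodule)

/-- The inclusion `E ⊂ L²(ℝ, dt)`. -/
def toL2 : S.TestSpace →ₗ[ℝ] RealL2 := S.testSubmodule.subtype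

theorem summable_coords (ξ : S.TestSpace) (p : ℕ) :
    Summable fun j => (S.lam j ^ p * ‖inner ℝ (S.e j) (S.toL2 ξ)‖) ^ 2 :=
  Subtype.property (p := fun ξ => ξ ∈ S.testSubmodule) ξ p

/-- The coordinates `⟨eⱼ, ξ⟩` of `ξ ∈ E`. -/
def coords : S.TestSpace →ₗ[ℝ] Koethe ℝ fun p j => S.lam j ^ p where
  toFun ξ := Koethe.mk (fun j => inner ℝ (S.e j) (S.toL2 ξ)) (S.summable_coords ξ)
  map_add' ξ η := Koethe.ext fun j => by
    rw [Koethe.add_apply, Koethe.mk_apply, Koethe.mk_apply, Koethe.mk_apply, map_add,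
      inner_add_right]
  map_smul' c ξ := Koethe.ext fun j => by
    rw [RingHom.id_apply, Koethe.smul_apply, Koethe.mk_apply, Koethe.mk_apply, map_smul,
      real_inner_smul_right]

@[simp] theorem coords_apply (ξ : S.TestSpace) (j : S.ι) :
    S.coords ξ j = inner ℝ (S.e j) (S.toL2 ξ) := rfl

/-- The norms `|ξ|_p = |A ^ p ξ|₀` on `E`. -/
def testNorms : SeminormFamily ℝ S.TestSpace ℕ := fun p => (Koethe.norms ℝ _ p).comp S.coords

instance : TopologicalSpace S.TestSpace := S.testNorms.moduleFilterBasis.topology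

theorem testWithSeminorms : WithSeminorms S.testNorms := ⟨rfl⟩

instance : IsTopologicalAddGroup S.TestSpace := S.testWithSeminorms.topologicalAddGroup

instance : ContinuousSMul ℝ S.TestSpace := S.testWithSeminorms.continuousSMul

/-- The space `E*`, the topological dual of `E`. -/
abbrev DualSpace : Type := S.TestSpace →L[ℝ] ℝ

/-- The eigenvector `eⱼ` as an element of `E`. -/
def basisVec (j : S.ι) : S.TestSpace := ⟨S.e j, fun p => by
  classical
  refine summable_of_ne_finset_zero (s := {j}) fun i hi => ?_
  have : inner ℝ (S.e i) (S.e j) = 0 := S.e.orthonormal.2 (by simpa using hi)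
  simp [this]⟩

@[simp] theorem toL2_basisVec (j : S.ι) : S.toL2 (S.basisVec j) = S.e j := rfl

/-- The weight `(λ_{J 1} ⋯ λ_{J n}) ^ p`: the eigenvalue of `(A ^ p)^{⊗ n}` at
`e_{J 1} ⊗ ⋯ ⊗ e_{J n}`. -/
def weight (n p : ℕ) (J : Fin n → S.ι) : ℝ := ∏ i, S.lam (J i) ^ p

theorem weight_pos (n p : ℕ) (J : Fin n → S.ι) : 0 < S.weight n p J :=
  Finset.prod_pos fun _ _ => pow_pos (one_pos.trans_le (S.one_le _)) _

theorem weight_mono (n : ℕ) {p q : ℕ} (h : p ≤ q) (J : Fin n → S.ι) :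
    S.weight n p J ≤ S.weight n q J :=
  Finset.prod_le_prod (fun _ _ => pow_nonneg (zero_le_one.trans (S.one_le _)) _)
    fun _ _ => pow_le_pow_right₀ (S.one_le _) h

/-- The completed tensor power `E_ℂ^{⊗ n}`; `f J` is the coefficient of `f` at
`e_{J 1} ⊗ ⋯ ⊗ e_{J n}`, and the norms are `|f|_p = |(A ^ p)^{⊗ n} f|₀`. -/
abbrev Tensor (n : ℕ) : Type := Koethe ℂ (S.weight n)

/-- The dual space `(E_ℂ^{⊗ n})*`. -/
abbrev Dual (n : ℕ) : Type := S.Tensor n →L[ℂ] ℂ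

variable {S}

theorem Tensor.norms_mono (n : ℕ) : Monotone (Koethe.norms ℂ (S.weight n)) := fun _ _ h =>
  Koethe.norms_mono (fun p J => (S.weight_pos n p J).le) (fun _ _ h J => S.weight_mono n h J) h

theorem summable_permute {n : ℕ} (σ : Equiv.Perm (Fin n)) (f : S.Tensor n) (p : ℕ) :
    Summable (fun J => (S.weight n p J * ‖f (J ∘ σ)‖) ^ 2) ∧
      ∑' J, (S.weight n p J * ‖f (J ∘ σ)‖) ^ 2 = ∑' J, (S.weight n p J * ‖f J‖) ^ 2 := by
  let e := Equiv.arrowCongr σ.symm (Equiv.refl S.ι)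
  have h : (fun J => (S.weight n p J * ‖f J‖) ^ 2) ∘ e =
      fun J => (S.weight n p J * ‖f (J ∘ σ)‖) ^ 2 := by
    funext J
    have h1 : e J = J ∘ σ := rfl
    have h2 : S.weight n p (J ∘ σ) = S.weight n p J :=
      Equiv.prod_comp σ fun i => S.lam (J i) ^ p
    simp only [Function.comp_apply, h1, h2]
  exact ⟨h ▸ e.summable_iff.2 (f.summable p), h ▸ e.tsum_eq fun J => (S.weight n p J * ‖f J‖) ^ 2⟩

/-- The action of a permutation of the tensor factors on `E_ℂ^{⊗ n}`. -/
def permute {n : ℕ} (σ : Equiv.Perm (Fin n)) : S.Tensor n →L[ℂ] S.Tensor n :=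
  let T : S.Tensor n →ₗ[ℂ] S.Tensor n :=
    { toFun := fun f => Koethe.mk (fun J => f (J ∘ σ)) fun p => (summable_permute σ f p).1
      map_add' := fun _ _ => rfl
      map_smul' := fun _ _ => rfl }
  ⟨T, Koethe.continuous_of_bound T fun p => ⟨p, 1, zero_le_one, fun f => by
    rw [one_mul]
    refine (pow_le_pow_iff_left₀ (apply_nonneg _ _) (apply_nonneg _ _) two_ne_zero).1 ?_
    rw [Koethe.norms_sq, Koethe.norms_sq]
    exact (summable_permute σ f p).2.le⟩⟩

/-- `f ∈ (E_ℂ^{⊗ n})_sym`. -/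
def IsSymm {n : ℕ} (f : S.Tensor n) : Prop := ∀ σ : Equiv.Perm (Fin n), permute σ f = f

/-- `κ ∈ (E_ℂ^{⊗ n})*_sym`. -/
def IsSymmDual {n : ℕ} (κ : S.Dual n) : Prop :=
  ∀ (σ : Equiv.Perm (Fin n)) (f : S.Tensor n), κ (permute σ f) = κ f

/-- Concatenation of multi-indices. -/
def join {a b n : ℕ} (h : a + b = n) : (Fin a → S.ι) × (Fin b → S.ι) ≃ (Fin n → S.ι) :=
  (Fin.appendEquiv a b).trans (Equiv.arrowCongr (finCongr h) (Equiv.refl S.ι))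

theorem weight_join {a b n : ℕ} (h : a + b = n) (p : ℕ) (J : Fin a → S.ι) (K : Fin b → S.ι) :
    S.weight n p (join h (J, K)) = S.weight a p J * S.weight b p K := by
  subst h
  have : join rfl (J, K) = Fin.append J K := rfl
  simp [weight, this, Fin.prod_univ_add]

theorem summable_slice {a b n : ℕ} (h : a + b = n) (f : S.Tensor n) (J : Fin a → S.ι) (p : ℕ) :
    Summable fun K => (S.weight b p K * ‖f (join h (J, K))‖) ^ 2 := by
  have h1 := ((join h).summable_iff.2 (f.summable p)).prod_factor J
  refine (h1.mul_left ((S.weight a p J ^ 2)⁻¹)).congr fun K => ?_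
  have := (S.weight_pos a p J).ne'
  simp only [Function.comp_apply, weight_join]
  field_simp

/-- The slice `K ↦ f (J, K)`, an element of `E_ℂ^{⊗ b}`, of an `f ∈ E_ℂ^{⊗ (a + b)}`. -/
def slice {a b n : ℕ} (h : a + b = n) (f : S.Tensor n) (J : Fin a → S.ι) : S.Tensor b :=
  Koethe.mk (fun K => f (join h (J, K))) (summable_slice h f J)

theorem contract_aux {a b n : ℕ} (h : a + b = n) (κ : S.Dual b) (p : ℕ) :
    ∃ (q : ℕ) (C : ℝ), 0 ≤ C ∧ ∀ f : S.Tensor n,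
      Summable (fun J => (S.weight a p J * ‖κ (slice h f J)‖) ^ 2) ∧
      ∑' J, (S.weight a p J * ‖κ (slice h f J)‖) ^ 2 ≤
        (C * Koethe.norms ℂ (S.weight n) q f) ^ 2 := by
  obtain ⟨q, C, hC, hκ⟩ := exists_bound (Koethe.withSeminorms ℂ _) (Tensor.norms_mono b) κ
  refine ⟨max p q, C, hC, fun f => ?_⟩
  have hs := (join h).summable_iff.2 (f.summable (max p q))
  have hle : ∀ J, (S.weight a p J * ‖κ (slice h f J)‖) ^ 2 ≤
      C ^ 2 * ∑' K, ((fun J => (S.weight n (max p q) J * ‖f J‖) ^ 2) ∘ join h) (J, K) := by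
    intro J
    have h1 : ‖κ (slice h f J)‖ ≤ C * Koethe.norms ℂ (S.weight b) (max p q) (slice h f J) :=
      (hκ _).trans (mul_le_mul_of_nonneg_left
        (Tensor.norms_mono b (le_max_right p q) _) hC)
    have h2 : S.weight a p J * ‖κ (slice h f J)‖ ≤ S.weight a (max p q) J *
        (C * Koethe.norms ℂ (S.weight b) (max p q) (slice h f J)) :=
      mul_le_mul (S.weight_mono a (le_max_left p q) J) h1 (norm_nonneg _)
        (S.weight_pos a _ J).le
    refine (pow_le_pow_left₀ (mul_nonneg (S.weight_pos a p J).le (norm_nonneg _)) h2 2).trans_eq ?_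
    rw [mul_pow, mul_pow, Koethe.norms_sq, mul_left_comm, ← tsum_mul_left]
    congr 1
    refine tsum_congr fun K => ?_
    simp only [Function.comp_apply, weight_join, slice, Koethe.mk_apply]
    ring
  have hS := hs.prod.mul_left (C ^ 2)
  have h0 := Summable.of_nonneg_of_le (fun J => sq_nonneg _) hle hS
  refine ⟨h0, (h0.tsum_le_tsum hle hS).trans_eq ?_⟩
  have he := (join h).tsum_eq fun J => (S.weight n (max p q) J * ‖f J‖) ^ 2
  rw [tsum_mul_left, ← hs.tsum_prod, mul_pow, Koethe.norms_sq, ← he]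
  rfl

/-- The right contraction `κ ⊗_b f ∈ E_ℂ^{⊗ a}` of `f ∈ E_ℂ^{⊗ (a + b)}` with
`κ ∈ (E_ℂ^{⊗ b})*`: the functional `κ` acts on the last `b` tensor factors of `f`. -/
def contract {a b n : ℕ} (h : a + b = n) (κ : S.Dual b) : S.Tensor n →L[ℂ] S.Tensor a :=
  let T : S.Tensor n →ₗ[ℂ] S.Tensor a :=
    { toFun := fun f => Koethe.mk (fun J => κ (slice h f J)) fun p => by
        obtain ⟨q, C, -, hf⟩ := contract_aux h κ p
        exact (hf f).1
      map_add' := fun f g => Koethe.ext fun J => map_add κ (slice h f J) (slice h g J)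
      map_smul' := fun c f => Koethe.ext fun J => map_smul κ c (slice h f J) }
  ⟨T, Koethe.continuous_of_bound T fun p => by
    obtain ⟨q, C, hC, hf⟩ := contract_aux h κ p
    refine ⟨q, C, hC, fun f => ?_⟩
    refine (pow_le_pow_iff_left₀ (apply_nonneg _ _)
      (mul_nonneg hC (apply_nonneg _ _)) two_ne_zero).1 ?_
    rw [Koethe.norms_sq]
    exact (hf f).2⟩

/-! ### Tensor products in the dual spaces and Wick tensors -/

/-- The tensor product `κ₁ ⊗ κ₂ ∈ (E_ℂ^{⊗ (a + b)})*`. -/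
def tensor {a b n : ℕ} (h : a + b = n) (κ₁ : S.Dual a) (κ₂ : S.Dual b) : S.Dual n :=
  κ₁.comp (contract h κ₂)

/-- The symmetrization of `κ ∈ (E_ℂ^{⊗ n})*`. -/
def symmetrize {n : ℕ} (κ : S.Dual n) : S.Dual n :=
  ((n.factorial : ℂ)⁻¹) • ∑ σ : Equiv.Perm (Fin n), κ.comp (permute σ)

/-- The symmetric tensor product `κ₁ ⊗̂ κ₂`. -/
def symTensor {a b n : ℕ} (h : a + b = n) (κ₁ : S.Dual a) (κ₂ : S.Dual b) : S.Dual n :=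
  symmetrize (tensor h κ₁ κ₂)

/-- The functional `1 ∈ (E_ℂ^{⊗ 0})* = ℂ`. -/
def one : S.Dual 0 := Koethe.pairing (fun _ => 1) ⟨0, S.weight_pos 0 0, Summable.of_finite⟩

/-- The tensor power `κ^{⊗ k} ∈ (E_ℂ^{⊗ (r k)})*` of `κ ∈ (E_ℂ^{⊗ r})*`. -/
def tensorPow {r : ℕ} (κ : S.Dual r) : (k : ℕ) → S.Dual (r * k)
  | 0 => one
  | k + 1 => tensor (Nat.mul_succ r k).symm (tensorPow κ k) κ

/-- The symmetric tensor power `κ^{⊗̂ k}`. -/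
def symTensorPow {r : ℕ} (κ : S.Dual r) (k : ℕ) : S.Dual (r * k) := symmetrize (tensorPow κ k)

theorem summable_pointPow (x : S.DualSpace) (n : ℕ) :
    ∃ p, (∀ J, 0 < S.weight n p J) ∧
      Summable fun J => ((S.weight n p J)⁻¹ * ‖∏ i, (x (S.basisVec (J i)) : ℂ)‖) ^ 2 := by
  have hm : Monotone S.testNorms := fun p q h ξ =>
    Koethe.norms_mono (fun p j => pow_nonneg (zero_le_one.trans (S.one_le j)) p)
      (fun p q h j => pow_le_pow_right₀ (S.one_le j) h) h (S.coords ξ)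
  obtain ⟨q, C, hC, hx⟩ := exists_bound S.testWithSeminorms hm x
  have hb : ∀ j, S.testNorms q (S.basisVec j) = S.lam j ^ q := by
    intro j
    have hj : 0 ≤ S.lam j ^ q := pow_nonneg (zero_le_one.trans (S.one_le j)) q
    refine (pow_left_inj₀ (apply_nonneg _ _) hj two_ne_zero).1 ?_
    have h1 : S.testNorms q (S.basisVec j) ^ 2 =
        ∑' i, (S.lam i ^ q * ‖(S.coords (S.basisVec j)) i‖) ^ 2 := Koethe.norms_sq q _
    rw [h1, tsum_eq_single j]
    · have : (S.coords (S.basisVec j)) j = 1 := by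
        rw [coords_apply, toL2_basisVec, real_inner_self_eq_norm_sq, S.e.orthonormal.1 j, one_pow]
      simp [this]
    · intro i hi
      have : (S.coords (S.basisVec j)) i = 0 := by
        rw [coords_apply, toL2_basisVec]
        exact S.e.orthonormal.2 hi
      simp [this]
  refine ⟨q + 1, S.weight_pos n _, ?_⟩
  have hg := S.summable_inv_sq.mul_left (C ^ 2)
  have h0 : ∀ j, 0 ≤ C ^ 2 * (S.lam j ^ 2)⁻¹ := fun j => by positivity
  refine Summable.of_nonneg_of_le (fun J => sq_nonneg _) (fun J => ?_) (summable_pi_prod h0 hg n)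
  rw [weight, norm_prod, ← Finset.prod_inv_distrib, ← Finset.prod_mul_distrib, ← Finset.prod_pow]
  refine Finset.prod_le_prod (fun i _ => sq_nonneg _) fun i _ => ?_
  have hl : 0 < S.lam (J i) := one_pos.trans_le (S.one_le _)
  have h1 := hx (S.basisVec (J i))
  rw [hb] at h1
  rw [Complex.norm_real]
  calc ((S.lam (J i) ^ (q + 1))⁻¹ * ‖x (S.basisVec (J i))‖) ^ 2
      ≤ ((S.lam (J i) ^ (q + 1))⁻¹ * (C * S.lam (J i) ^ q)) ^ 2 := by gcongr
    _ = C ^ 2 * (S.lam (J i) ^ 2)⁻¹ := by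
        field_simp
        ring

/-- The tensor power `x^{⊗ n} ∈ (E_ℂ^{⊗ n})*` of `x ∈ E*`. -/
def pointPow (x : S.DualSpace) (n : ℕ) : S.Dual n :=
  Koethe.pairing (fun J => ∏ i, (x (S.basisVec (J i)) : ℂ)) (summable_pointPow x n)

theorem mul_le_of_fin {r n : ℕ} (k : Fin (n / r + 1)) : r * (k : ℕ) ≤ n :=
  (Nat.mul_le_mul_left r (Nat.lt_succ_iff.1 k.2)).trans (Nat.mul_div_le n r)

/-- The renormalized tensor power (generalized Wick tensor)
`:x^{⊗ n}:_κ = ∑_{k ≤ n / r} n! / ((n - r k)! k!) (-½)^k x^{⊗ (n - r k)} ⊗̂ κ^{⊗̂ k}`. -/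
def genWick {r : ℕ} (κ : S.Dual r) (x : S.DualSpace) (n : ℕ) : S.Dual n :=
  ∑ k : Fin (n / r + 1),
    ((n.factorial : ℂ) / ((n - r * (k : ℕ)).factorial * (k : ℕ).factorial) * (-(1 / 2)) ^ (k : ℕ)) •
      symTensor (Nat.sub_add_cancel (mul_le_of_fin k))
        (pointPow x (n - r * (k : ℕ))) (symTensorPow κ k)

open Classical in
theorem summable_trace : ∃ p, (∀ J, 0 < S.weight 2 p J) ∧
    Summable fun J => ((S.weight 2 p J)⁻¹ * ‖(if J 0 = J 1 then 1 else 0 : ℂ)‖) ^ 2 := by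
  refine ⟨1, S.weight_pos 2 1, ?_⟩
  have hinj : Function.Injective fun (j : S.ι) (_ : Fin 2) => j := fun i j h => congrFun h 0
  rw [← hinj.summable_iff]
  · refine Summable.of_nonneg_of_le (fun j => sq_nonneg _) (fun j => ?_) S.summable_inv_sq
    have hl := S.one_le j
    have h1 : S.lam j ^ 2 ≤ (S.lam j ^ 2) ^ 2 := le_self_pow₀ (one_le_pow₀ hl) two_ne_zero
    have h2 : 0 < S.lam j ^ 2 := by positivity
    have h3 : S.weight 2 1 (fun _ => j) = S.lam j ^ 2 := by simp [weight]
    simp only [Function.comp_apply, h3, if_true, norm_one, mul_one, inv_pow]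
    exact inv_anti₀ h2 h1
  · intro J hJ
    have : J 0 ≠ J 1 := fun h => hJ ⟨J 0, by
      funext i
      fin_cases i
      · rfl
      · exact h⟩
    simp [this]

open Classical in
/-- The trace `τ ∈ (E_ℂ^{⊗ 2})*`, `⟨τ, ξ ⊗ η⟩ = ⟨ξ, η⟩`. -/
def trace : S.Dual 2 := Koethe.pairing (fun J => if J 0 = J 1 then 1 else 0) summable_trace

/-- The Wick ordering
`:x^{⊗ n}: = ∑_{k ≤ n / 2} (n choose 2k) (2k - 1)!! (-1)^k x^{⊗ (n - 2k)} ⊗̂ τ^{⊗ k}`. -/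
def wick (x : S.DualSpace) (n : ℕ) : S.Dual n :=
  ∑ k : Fin (n / 2 + 1),
    ((n.choose (2 * (k : ℕ)) : ℂ) * (Nat.doubleFactorial (2 * (k : ℕ) - 1) : ℂ) * (-1) ^ (k : ℕ)) •
      symTensor (Nat.sub_add_cancel (mul_le_of_fin k))
        (pointPow x (n - 2 * (k : ℕ))) (tensorPow trace k)

/-! ### White noise test functions and operators -/

variable (S) in
/-- The weight of the norm `|φ|²_{p,β} = ∑ₙ (n!)^{1+β} |fₙ|²_p`. -/
def fockWeight (β : ℝ) (p : ℕ) (a : Σ n : ℕ, Fin n → S.ι) : ℝ :=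
  (a.1.factorial : ℝ) ^ ((1 + β) / 2) * S.weight a.1 p a.2

variable (S) in
/-- The space `(E)_β` of white noise test functions `φ ∼ (fₙ)`, given by the sequence of its
chaos coefficients `fₙ ∈ (E_ℂ^{⊗ n})_sym`, `φ ⟨n, J⟩ = fₙ J`, with `|φ|_{p,β} < ∞` for all `p`;
the topology is given by the norms `|φ|_{p,β}`. -/
def testFunctions (β : ℝ) : Submodule ℂ (Koethe ℂ (S.fockWeight β)) where
  carrier := {φ | ∀ (n : ℕ) (σ : Equiv.Perm (Fin n)) (J : Fin n → S.ι),
    φ ⟨n, J ∘ σ⟩ = φ ⟨n, J⟩}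
  add_mem' := fun hφ hψ n σ J => congrArg₂ (· + ·) (hφ n σ J) (hψ n σ J)
  zero_mem' := fun _ _ _ => rfl
  smul_mem' := fun c _ hφ n σ J => congrArg (c * ·) (hφ n σ J)

/-- The chaos coefficient `fₙ` of `φ ∼ (fₙ)`. -/
def chaos {β : ℝ} (φ : S.testFunctions β) (n : ℕ) : S.Tensor n :=
  Koethe.mk (fun J => φ.1 ⟨n, J⟩) fun p => by
    have h1 := (φ.1.summable p).comp_injective (sigma_mk_injective (i := n))
    have hn : ((n.factorial : ℝ) ^ ((1 + β) / 2)) ≠ 0 :=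
      (Real.rpow_pos_of_pos (by exact_mod_cast n.factorial_pos) _).ne'
    refine (h1.mul_left (((n.factorial : ℝ) ^ ((1 + β) / 2)) ^ 2)⁻¹).congr fun J => ?_
    simp only [Function.comp_apply, fockWeight]
    field_simp

/-- `φ ∼ (fₙ)` is the function `F` on `E*`: `F x = ∑ₙ ⟨:x^{⊗ n}:, fₙ⟩` for every `x ∈ E*`. -/
def IsFunction {β : ℝ} (φ : S.testFunctions β) (F : S.DualSpace → ℂ) : Prop :=
  ∀ x, HasSum (fun n => wick x n (chaos φ n)) (F x)

/-- `T` is the integral kernel operator `Ξ_{0,r}(κ)` on `(E)_β`: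
`T φ = ∑ₙ (n + r)! / n! ⟨:x^{⊗ n}:, κ ⊗_r f_{n + r}⟩` for `φ ∼ (fₙ)`. -/
def IsIntegralKernelOperator {β : ℝ} {r : ℕ} (κ : S.Dual r)
    (T : S.testFunctions β →L[ℂ] S.testFunctions β) : Prop :=
  ∀ φ n, chaos (T φ) n = ((n + r).factorial / n.factorial : ℂ) • contract rfl κ (chaos φ (n + r))

/-- `U = exp T`: the series `∑ₙ Tⁿ / n!` converges to `U` in `L((E)_β, (E)_β)`, for the topology of
uniform convergence on bounded sets. -/
def IsExp {β : ℝ} (T U : S.testFunctions β →L[ℂ] S.testFunctions β) : Prop :=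
  HasSum (fun n : ℕ => ((n.factorial : ℂ)⁻¹) • T ^ n) U

/-- `ψ` is the exponential vector `Φ_ζ ∼ (ζ^{⊗ n} / n!)` of `ζ = ξ + i η ∈ E_ℂ`. -/
def IsExpVector {β : ℝ} (ψ : S.testFunctions β) (ξ η : S.TestSpace) : Prop :=
  ∀ (n : ℕ) (J : Fin n → S.ι), chaos ψ n J =
    ((n.factorial : ℂ)⁻¹) * ∏ i, ((S.coords ξ (J i) : ℂ) + Complex.I * (S.coords η (J i) : ℂ))

/-- The defining property of the renormalization operator on `(E) = (E)_0`: for every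
`ζ = ξ + i η ∈ E_ℂ` it maps the test function `exp⟨·, ζ⟩` to `Φ_ζ`. -/
def IsRenormalization (Θ : S.testFunctions 0 →L[ℂ] S.testFunctions 0) : Prop :=
  ∀ ξ η : S.TestSpace, ∃ φ : S.testFunctions 0,
    IsFunction φ (fun x => Complex.exp ((x ξ : ℂ) + Complex.I * (x η : ℂ))) ∧
      IsExpVector (Θ φ) ξ η

end Eigenbasis

end WhiteNoise

end

open WhiteNoise WhiteNoise.Eigenbasis

/-!
The exponential vectors `Φ_z = (z^{⊗n} / n!)_n` are common eigenvectors of the integral kernel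
operators: `Ξ(κ) Φ_z = ⟨κ, z^{⊗r}⟩ Φ_z`, hence `exp (t Ξ(κ)) Φ_z = exp (t ⟨κ, z^{⊗r}⟩) Φ_z`. They
span a dense subspace, so the group law of `t ↦ exp (t Ξ(κ))` and the commutation of the operators
for different kernels follow from identities between numbers.

Evaluating the Wick series `∑ ⟨:x^{⊗n}:, g_n⟩` of `φ ∼ (g_n)` amounts to evaluating the plain power
series `∑ ⟨x^{⊗n}, f_n⟩` of `exp (-½ Δ_G) φ ∼ (f_n)`, and `exp (-½ Δ_G)` is invertible. Since the
coefficients of a power series are determined by its sum, a function on `E*` is represented by at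
most one `φ`, and `⟨x^{⊗m}, f_m⟩` is represented by `exp (½ Δ_G) f_m`; commuting `exp (-½ Ξ(κ))`
past `exp (½ Δ_G)` gives the function `⟨:x^{⊗m}:_κ, f_m⟩`.

The exponential series converges because `r (1 - β) ≤ 2` makes `((n + r k)! / n!)^{1 - β}` at most
`k!²` up to a factor that is geometric in `n` and `k`: the coefficient `1 / k!` of the series
cancels `k!`, and the spectral gap `inf σ(A) > 1` absorbs geometric factors into a stronger norm.
-/

noncomputable section

namespace WhiteNoise

section SeminormSeries

variable {𝕜 V ι γ : Type*} [RCLike 𝕜] [AddCommGroup V] [Module 𝕜 V] [TopologicalSpace V]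
  {N : SeminormFamily 𝕜 V ι}

theorem hasSum_iff_tendsto_seminorm (hN : WithSeminorms N) {f : γ → V} {g : V} :
    HasSum f g ↔ ∀ p, Filter.Tendsto (fun s : Finset γ => N p (∑ k ∈ s, f k - g))
      Filter.atTop (nhds 0) := by
  rw [HasSum, SummationFilter.unconditional_filter, hN.tendsto_nhds]
  refine forall_congr' fun p => ?_
  rw [Metric.tendsto_nhds]
  refine forall₂_congr fun ε _ => ?_
  simp [abs_of_nonneg (apply_nonneg (N p) _)]

theorem seminorm_le_tsum_of_hasSum (hN : WithSeminorms N) {f : γ → V} {g : V} {a : γ → ℝ}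
    (hf : HasSum f g) (p : ι) (hfa : ∀ k, N p (f k) ≤ a k) (ha : Summable a) :
    N p g ≤ ∑' k, a k := by
  refine le_of_tendsto (((hN.continuous_seminorm p).tendsto g).comp hf)
    (Filter.Eventually.of_forall fun s => ?_)
  calc N p (∑ k ∈ s, f k)
      ≤ ∑ k ∈ s, N p (f k) :=
        Finset.le_sum_of_subadditive (N p) (map_zero (N p)).le (map_add_le_add (N p)) s f
    _ ≤ ∑ k ∈ s, a k := Finset.sum_le_sum fun k _ => hfa k
    _ ≤ ∑' k, a k := ha.sum_le_tsum s fun k _ => (apply_nonneg _ _).trans (hfa k)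

theorem seminorm_sub_sum_le_of_hasSum [IsTopologicalAddGroup V] (hN : WithSeminorms N)
    {f : γ → V} {g : V} {a : γ → ℝ} (hf : HasSum f g) (p : ι) (hfa : ∀ k, N p (f k) ≤ a k)
    (ha : Summable a) (s : Finset γ) :
    N p (g - ∑ k ∈ s, f k) ≤ ∑' k : {k // k ∉ s}, a k := by
  have htail : HasSum (fun k : {k // k ∉ s} => f k) (g - ∑ k ∈ s, f k) :=
    s.hasSum_compl_iff.2 (by simpa using hf)
  exact seminorm_le_tsum_of_hasSum hN htail p (fun k => hfa k) (ha.subtype {k | k ∉ s})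

variable {T : γ → V →L[𝕜] V} {ε : γ → ℝ}

theorem exists_clm_hasSum_apply [IsTopologicalAddGroup V] [ContinuousSMul 𝕜 V] [T2Space V]
    (hN : WithSeminorms N)
    (hcomplete : ∀ f : γ → V, (∀ p, Summable fun k => N p (f k)) → Summable f)
    (hε : Summable ε) (hT : ∀ p, ∃ q, ∀ k φ, N p (T k φ) ≤ ε k * N q φ) :
    ∃ U : V →L[𝕜] V, ∀ φ, HasSum (fun k => T k φ) (U φ) := by
  have hsummable (φ : V) : Summable fun k => T k φ := hcomplete _ fun p => by
    obtain ⟨q, hq⟩ := hT p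
    exact .of_nonneg_of_le (fun k => apply_nonneg _ _) (fun k => hq k φ) (hε.mul_right (N q φ))
  let U : V →ₗ[𝕜] V :=
    { toFun := fun φ => ∑' k, T k φ
      map_add' := fun φ ψ => by simp only [map_add, (hsummable φ).tsum_add (hsummable ψ)]
      map_smul' := fun c φ => by
        simp only [map_smul, (hsummable φ).tsum_const_smul c, RingHom.id_apply] }
  have hU : Continuous U := by
    refine WithSeminorms.continuous_of_isBounded hN hN U (Seminorm.IsBounded.of_real fun p => ?_)
    obtain ⟨q, hq⟩ := hT p
    refine ⟨{q}, ∑' k, ε k, fun φ => ?_⟩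
    rw [Finset.sup_singleton]
    refine (seminorm_le_tsum_of_hasSum hN (hsummable φ).hasSum p (fun k => hq k φ)
      (hε.mul_right (N q φ))).trans_eq tsum_mul_right
  exact ⟨⟨U, hU⟩, fun φ => (hsummable φ).hasSum⟩

theorem hasSum_clm_of_hasSum_apply [IsTopologicalAddGroup V]
    (hN : WithSeminorms N) (hε : Summable ε) (hT : ∀ p, ∃ q, ∀ k φ, N p (T k φ) ≤ ε k * N q φ)
    {U : V →L[𝕜] V} (hU : ∀ φ, HasSum (fun k => T k φ) (U φ)) : HasSum T U := by
  have hbound (p : ι) {B : Set V} (hB : Bornology.IsVonNBounded 𝕜 B) {r : ℝ} (hr : 0 < r) :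
      ∀ᶠ s : Finset γ in Filter.atTop, ∀ φ ∈ B, N p ((∑ k ∈ s, T k - U) φ) < r := by
    obtain ⟨q, hq⟩ := hT p
    obtain ⟨R, -, hBR⟩ := hN.isVonNBounded_iff_seminorm_bounded.1 hB q
    have htail := ((tendsto_tsum_compl_atTop_zero ε).abs.mul_const R)
    rw [abs_zero, zero_mul] at htail
    filter_upwards [htail.eventually (gt_mem_nhds hr)] with s hs φ hφ
    have hrem : N p (U φ - ∑ k ∈ s, T k φ) ≤ (∑' k : {k // k ∉ s}, ε k) * N q φ :=
      (seminorm_sub_sum_le_of_hasSum hN (hU φ) p (fun k => hq k φ)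
        (hε.mul_right (N q φ)) s).trans_eq tsum_mul_right
    rw [sub_apply, sum_apply, map_sub_rev]
    exact (hrem.trans (mul_le_mul (le_abs_self _) (hBR φ hφ).le (apply_nonneg _ _)
      (abs_nonneg _))).trans_lt hs
  rw [HasSum, SummationFilter.unconditional_filter, ← tendsto_sub_nhds_zero_iff,
    (ContinuousLinearMap.hasBasis_nhds_zero_of_basis hN.hasBasis_zero_ball).tendsto_right_iff]
  rintro ⟨B, I, r⟩ ⟨hB, hr⟩
  filter_upwards [(Filter.eventually_all_finset I).2 fun p _ => hbound p hB hr] with s hs φ hφ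
  rw [Seminorm.mem_ball_zero]
  exact Seminorm.finset_sup_apply_lt hr fun p hp => hs p hp φ hφ

end SeminormSeries

namespace Koethe

variable {𝕜 : Type} [RCLike 𝕜] {α : Type} {w : ℕ → α → ℝ}

@[simp] theorem zero_apply (a : α) : (0 : Koethe 𝕜 w) a = 0 := rfl

@[simp] theorem sub_apply (f g : Koethe 𝕜 w) (a : α) : (f - g) a = f a - g a := rfl

@[simp] theorem sum_apply {γ : Type*} (s : Finset γ) (f : γ → Koethe 𝕜 w) (a : α) :
    (∑ k ∈ s, f k) a = ∑ k ∈ s, f k a := by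
  classical
  induction s using Finset.induction_on with
  | empty => simp
  | insert k s hk ih => rw [Finset.sum_insert hk, Finset.sum_insert hk, add_apply, ih]

theorem mul_norm_apply_le_norms {p : ℕ} {a : α} (hw : 0 ≤ w p a) (f : Koethe 𝕜 w) :
    w p a * ‖f a‖ ≤ norms 𝕜 w p f := by
  refine (pow_le_pow_iff_left₀ (mul_nonneg hw (norm_nonneg _)) (apply_nonneg _ _)
    two_ne_zero).1 ?_
  rw [norms_sq]
  exact (f.summable p).le_tsum a fun b _ => sq_nonneg _

/-- The coordinate functional `f ↦ f a`, which is continuous as soon as some weight at `a` is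
positive. -/
def coordL (a : α) (hw : ∃ p, 0 < w p a) : Koethe 𝕜 w →L[𝕜] 𝕜 where
  toFun f := f a
  map_add' _ _ := rfl
  map_smul' _ _ := rfl
  cont := by
    obtain ⟨p, hw⟩ := hw
    let T : Koethe 𝕜 w →ₗ[𝕜] 𝕜 :=
      { toFun := fun f => f a, map_add' := fun _ _ => rfl, map_smul' := fun _ _ => rfl }
    refine WithSeminorms.continuous_normedSpace_rng 𝕜 (withSeminorms 𝕜 w) T
      ⟨{p}, ⟨(w p a)⁻¹, (inv_pos.2 hw).le⟩, fun f => ?_⟩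
    have h : ‖f a‖ ≤ (w p a)⁻¹ * norms 𝕜 w p f := by
      rw [← div_eq_inv_mul, le_div_iff₀' hw]
      exact mul_norm_apply_le_norms hw.le f
    rwa [Finset.sup_singleton]

theorem t2Space (hw : ∀ a, ∃ p, 0 < w p a) : T2Space (Koethe 𝕜 w) := by
  refine ⟨fun f g hfg => ?_⟩
  obtain ⟨a, ha⟩ : ∃ a, f a ≠ g a := by
    by_contra! h
    exact hfg (Koethe.ext h)
  exact separated_by_continuous (coordL a (hw a)).continuous ha

theorem summable_of_summable_norms {γ : Type*} (hw : ∀ p a, 0 < w p a) {f : γ → Koethe 𝕜 w}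
    (hf : ∀ p, Summable fun k => norms 𝕜 w p (f k)) : Summable f := by
  have hsum (p : ℕ) : ∃ G, HasSum (fun k => toLp 𝕜 w p (f k)) G :=
    Summable.of_norm (f := fun k => toLp 𝕜 w p (f k)) (hf p)
  choose G hG using hsum
  have hcoord (p : ℕ) (a : α) : HasSum (fun k => (w p a : 𝕜) * f k a) (G p a) :=
    (hG p).map (lp.evalCLM 𝕜 (fun _ : α => 𝕜) 2 a) (lp.evalCLM 𝕜 (fun _ : α => 𝕜) 2 a).continuous
  let g (a : α) : 𝕜 := (w 0 a : 𝕜)⁻¹ * G 0 a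
  have hg (p : ℕ) (a : α) : (w p a : 𝕜) * g a = G p a := by
    refine HasSum.unique ?_ (hcoord p a)
    refine (((hcoord 0 a).mul_left (w 0 a : 𝕜)⁻¹).mul_left (w p a : 𝕜)).congr_fun fun k => ?_
    rw [inv_mul_cancel_left₀ (RCLike.ofReal_ne_zero.2 (hw 0 a).ne')]
  have hg_mem (p : ℕ) : Summable fun a => (w p a * ‖g a‖) ^ 2 := by
    rw [← memlp_two_iff, funext (hg p)]
    exact lp.memℓp (G p)
  have htoLp (p : ℕ) : toLp 𝕜 w p (mk g hg_mem) = G p := lp.ext (funext (hg p))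
  refine ⟨mk g hg_mem, (hasSum_iff_tendsto_seminorm (withSeminorms 𝕜 w)).2 fun p => ?_⟩
  refine (tendsto_iff_norm_sub_tendsto_zero.1 (hG p)).congr fun s => ?_
  rw [← htoLp, ← map_sum, ← map_sub]
  rfl

/-- The family which is `1` at `a` and `0` elsewhere. -/
def delta [DecidableEq α] (a : α) : Koethe 𝕜 w :=
  mk (Pi.single a 1) fun p => summable_of_ne_finset_zero (s := {a}) fun b hb => by
    rw [Pi.single_eq_of_ne (by simpa using hb)]
    simp

@[simp] theorem delta_apply [DecidableEq α] (a b : α) :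
    (delta a : Koethe 𝕜 w) b = (Pi.single a 1 : α → 𝕜) b := rfl

theorem sum_smul_delta_apply [DecidableEq α] (f : α → 𝕜) (s : Finset α) (b : α) :
    (∑ a ∈ s, f a • (delta a : Koethe 𝕜 w)) b = if b ∈ s then f b else 0 := by
  rw [sum_apply]
  simp [Pi.single_apply]

theorem hasSum_smul_delta [DecidableEq α] (f : Koethe 𝕜 w) :
    HasSum (fun a => f a • (delta a : Koethe 𝕜 w)) f := by
  refine (hasSum_iff_tendsto_seminorm (withSeminorms 𝕜 w)).2 fun p => ?_
  have htail := (Real.continuous_sqrt.tendsto 0).comp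
    (tendsto_tsum_compl_atTop_zero fun a => (w p a * ‖f a‖) ^ 2)
  rw [Real.sqrt_zero] at htail
  refine htail.congr fun s => ?_
  rw [Function.comp_apply, ← Real.sqrt_sq (apply_nonneg (norms 𝕜 w p) _), norms_sq]
  congr 1
  refine (tsum_subtype {a | a ∉ s} fun a => (w p a * ‖f a‖) ^ 2).trans ?_
  refine tsum_congr fun b => ?_
  rw [sub_apply, sum_smul_delta_apply]
  by_cases hb : b ∈ s <;> simp [hb]

theorem clm_ext [DecidableEq α] {V : Type*} [AddCommGroup V] [Module 𝕜 V] [TopologicalSpace V]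
    [T2Space V] {L M : Koethe 𝕜 w →L[𝕜] V} (h : ∀ a, L (delta a) = M (delta a)) : L = M := by
  ext f
  refine ((hasSum_smul_delta f).mapL L).unique
    (((hasSum_smul_delta f).mapL M).congr_fun fun a => ?_)
  rw [map_smul, map_smul, h]

end Koethe

namespace Eigenbasis

variable {A : RealL2 →ₗ.[ℝ] RealL2} {S : Eigenbasis A} {β : ℝ} {n : ℕ}

/-! ### Tensors and test functions -/

variable (S) in
/-- The norms `|f|_p = |(A ^ p)^{⊗ n} f|₀` on `E_ℂ^{⊗ n}`. -/
abbrev tensorNorms (n : ℕ) : SeminormFamily ℂ (S.Tensor n) ℕ := Koethe.norms ℂ (S.weight n)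

variable (S) in
theorem exists_pow_mul_tensorNorms_le : ∃ c : ℝ, 1 < c ∧ ∀ (n p s : ℕ) (f : S.Tensor n),
    c ^ (s * n) * S.tensorNorms n p f ≤ S.tensorNorms n (p + s) f := by
  obtain ⟨c, hc, hlam⟩ := S.one_lt
  have := one_pos.trans hc
  have hweight (n p s : ℕ) (J : Fin n → S.ι) :
      c ^ (s * n) * S.weight n p J ≤ S.weight n (p + s) J := by
    rw [weight, weight, pow_mul]
    calc (c ^ s) ^ n * ∏ i, S.lam (J i) ^ p = ∏ i, c ^ s * S.lam (J i) ^ p := by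
          rw [Finset.prod_mul_distrib, Finset.prod_const, Finset.card_univ, Fintype.card_fin]
      _ ≤ ∏ i, S.lam (J i) ^ (p + s) := by
          have hpos (i : Fin n) : 0 < S.lam (J i) := one_pos.trans_le (S.one_le _)
          refine Finset.prod_le_prod (fun i _ => ?_) fun i _ => ?_
          · have := hpos i
            positivity
          · rw [pow_add, mul_comm]
            have := hpos i
            have := hlam (J i)
            gcongr
  refine ⟨c, hc, fun n p s f => ?_⟩
  refine (pow_le_pow_iff_left₀ (by positivity) (apply_nonneg _ _) two_ne_zero).1 ?_
  rw [mul_pow, Koethe.norms_sq, Koethe.norms_sq, ← tsum_mul_left]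
  refine ((f.summable p).mul_left _).tsum_le_tsum (fun J => ?_) (f.summable (p + s))
  rw [← mul_pow, ← mul_assoc]
  have := S.weight_pos n p J
  gcongr
  exact hweight n p s J

theorem isSymm_iff {f : S.Tensor n} :
    IsSymm f ↔ ∀ (σ : Equiv.Perm (Fin n)) (J : Fin n → S.ι), f (J ∘ σ) = f J :=
  ⟨fun h σ J => DFunLike.congr_fun (h σ) J, fun h σ => Koethe.ext fun J => h σ J⟩

theorem isSymm_zero : IsSymm (0 : S.Tensor n) := fun _ => map_zero _

theorem tensorNorms_permute (σ : Equiv.Perm (Fin n)) (p : ℕ) (f : S.Tensor n) :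
    S.tensorNorms n p (permute σ f) = S.tensorNorms n p f := by
  refine (pow_left_inj₀ (apply_nonneg _ _) (apply_nonneg _ _) two_ne_zero).1 ?_
  rw [Koethe.norms_sq, Koethe.norms_sq]
  exact (summable_permute σ f p).2

/-- The projection of `E_ℂ^{⊗ n}` onto the symmetric tensors. -/
def symPart (n : ℕ) : S.Tensor n →L[ℂ] S.Tensor n :=
  ((n.factorial : ℂ)⁻¹) • ∑ σ : Equiv.Perm (Fin n), permute σ

theorem symPart_eq_smul_sum (f : S.Tensor n) :
    symPart n f = (n.factorial : ℂ)⁻¹ • ∑ σ : Equiv.Perm (Fin n), permute σ f := by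
  simp [symPart]

theorem symPart_apply (f : S.Tensor n) (J : Fin n → S.ι) :
    symPart n f J = (n.factorial : ℂ)⁻¹ * ∑ σ : Equiv.Perm (Fin n), f (J ∘ σ) := by
  rw [symPart_eq_smul_sum, Koethe.smul_apply, Koethe.sum_apply]
  rfl

theorem isSymm_symPart (f : S.Tensor n) : IsSymm (symPart n f) := by
  refine isSymm_iff.2 fun σ J => ?_
  rw [symPart_apply, symPart_apply]
  congr 1
  exact Equiv.sum_comp (Equiv.mulLeft σ) fun τ : Equiv.Perm (Fin n) => f (J ∘ τ)

theorem symPart_permute (σ : Equiv.Perm (Fin n)) (f : S.Tensor n) :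
    symPart n (permute σ f) = symPart n f := by
  refine Koethe.ext fun J => ?_
  rw [symPart_apply, symPart_apply]
  congr 1
  exact Equiv.sum_comp (Equiv.mulRight σ) fun τ : Equiv.Perm (Fin n) => f (J ∘ τ)

theorem IsSymm.symPart_eq {f : S.Tensor n} (hf : IsSymm f) : symPart n f = f := by
  have hn : (n.factorial : ℂ) ≠ 0 := by exact_mod_cast n.factorial_ne_zero
  rw [symPart_eq_smul_sum, Finset.sum_congr rfl fun σ _ => hf σ, Finset.sum_const,
    Finset.card_univ, Fintype.card_perm, Fintype.card_fin, ← Nat.cast_smul_eq_nsmul ℂ, smul_smul,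
    inv_mul_cancel₀ hn, one_smul]

theorem tensorNorms_symPart_le (p : ℕ) (f : S.Tensor n) :
    S.tensorNorms n p (symPart n f) ≤ S.tensorNorms n p f := by
  rw [symPart_eq_smul_sum, map_smul_eq_mul, norm_inv, Complex.norm_natCast,
    inv_mul_le_iff₀ (by exact_mod_cast n.factorial_pos)]
  refine (Finset.le_sum_of_subadditive (S.tensorNorms n p) (map_zero _).le
    (map_add_le_add _) _ _).trans_eq ?_
  simp [tensorNorms_permute, Fintype.card_perm]

variable (S β) in
theorem fockWeight_pos (p : ℕ) (a : Σ n : ℕ, Fin n → S.ι) : 0 < S.fockWeight β p a :=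
  mul_pos (Real.rpow_pos_of_pos (by exact_mod_cast a.1.factorial_pos) _) (S.weight_pos _ _ _)

theorem fockWeight_mul_sq (p n : ℕ) (J : Fin n → S.ι) (y : ℝ) :
    (S.fockWeight β p ⟨n, J⟩ * y) ^ 2 =
      (n.factorial : ℝ) ^ (1 + β) * (S.weight n p J * y) ^ 2 := by
  rw [fockWeight, mul_assoc, mul_pow, ← Real.rpow_mul_natCast (Nat.cast_nonneg _)]
  norm_num

instance : T2Space (Koethe ℂ (S.fockWeight β)) :=
  Koethe.t2Space fun a => ⟨0, S.fockWeight_pos β 0 a⟩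

variable (S β) in
/-- The norms `|φ|_{p,β}` on `(E)_β`. -/
def fockNorms : SeminormFamily ℂ (S.testFunctions β) ℕ := fun p =>
  (Koethe.norms ℂ (S.fockWeight β) p).comp (S.testFunctions β).subtype

theorem fockWithSeminorms : WithSeminorms (S.fockNorms β) :=
  Topology.IsInducing.withSeminorms (Koethe.withSeminorms ℂ (S.fockWeight β))
    (f := (S.testFunctions β).subtype) Topology.IsInducing.subtypeVal

theorem fockNorms_mono : Monotone (S.fockNorms β) := fun _ _ h φ =>
  Koethe.norms_mono (fun p a => (S.fockWeight_pos β p a).le)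
    (fun _ _ h a => mul_le_mul_of_nonneg_left (S.weight_mono a.1 h a.2) (by positivity)) h φ.1

@[simp] theorem chaos_add (φ ψ : S.testFunctions β) (n : ℕ) :
    chaos (φ + ψ) n = chaos φ n + chaos ψ n := rfl

@[simp] theorem chaos_smul (c : ℂ) (φ : S.testFunctions β) (n : ℕ) :
    chaos (c • φ) n = c • chaos φ n := rfl

theorem isSymm_chaos (φ : S.testFunctions β) (n : ℕ) : IsSymm (chaos φ n) :=
  isSymm_iff.2 fun σ J => φ.2 n σ J

theorem ext_chaos {φ ψ : S.testFunctions β} (h : ∀ n, chaos φ n = chaos ψ n) : φ = ψ :=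
  Subtype.ext (Koethe.ext fun a => DFunLike.congr_fun (h a.1) a.2)

/-- The continuous functional `φ ↦ fₙ J` for `φ ∼ (fₙ)`. -/
def chaosCoord (n : ℕ) (J : Fin n → S.ι) : S.testFunctions β →L[ℂ] ℂ :=
  (Koethe.coordL ⟨n, J⟩ ⟨0, S.fockWeight_pos β 0 _⟩).comp (S.testFunctions β).subtypeL

@[simp] theorem chaosCoord_apply (n : ℕ) (J : Fin n → S.ι) (φ : S.testFunctions β) :
    chaosCoord n J φ = chaos φ n J := rfl

theorem hasSum_fockNorms_sq (p : ℕ) (φ : S.testFunctions β) :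
    HasSum (fun n => (n.factorial : ℝ) ^ (1 + β) * S.tensorNorms n p (chaos φ n) ^ 2)
      (S.fockNorms β p φ ^ 2) := by
  have hsq : S.fockNorms β p φ ^ 2 = ∑' a, (S.fockWeight β p a * ‖φ.1 a‖) ^ 2 :=
    Koethe.norms_sq p φ.1
  rw [hsq]
  refine (φ.1.summable p).hasSum.sigma fun n => ?_
  rw [Koethe.norms_sq]
  exact (((chaos φ n).summable p).hasSum.mul_left _).congr_fun fun J => fockWeight_mul_sq p n J _

theorem fockNorms_le_of_chaos_le {φ ψ : S.testFunctions β} {p q d : ℕ} {M : ℝ} (hM : 0 ≤ M)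
    (h : ∀ n, (n.factorial : ℝ) ^ (1 + β) * S.tensorNorms n p (chaos ψ n) ^ 2 ≤
      M ^ 2 * (((n + d).factorial : ℝ) ^ (1 + β) *
        S.tensorNorms (n + d) q (chaos φ (n + d)) ^ 2)) :
    S.fockNorms β p ψ ≤ M * S.fockNorms β q φ := by
  have hφ := hasSum_fockNorms_sq q φ
  have hshift := hφ.summable.comp_injective (add_left_injective d)
  refine (pow_le_pow_iff_left₀ (apply_nonneg _ _) (mul_nonneg hM (apply_nonneg _ _))
    two_ne_zero).1 ?_
  rw [mul_pow]
  refine (hasSum_le h (hasSum_fockNorms_sq p ψ) (hshift.hasSum.mul_left (M ^ 2))).trans ?_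
  rw [← hφ.tsum_eq]
  exact mul_le_mul_of_nonneg_left
    (tsum_comp_le_tsum_of_inj hφ.summable (fun n => by positivity) (add_left_injective d))
    (sq_nonneg M)

theorem summable_of_summable_fockNorms {γ : Type*} {f : γ → S.testFunctions β}
    (hf : ∀ p, Summable fun k => S.fockNorms β p (f k)) : Summable f := by
  obtain ⟨g, hg⟩ := Koethe.summable_of_summable_norms (f := fun k => (f k).1)
    (S.fockWeight_pos β) hf
  have hcoord (a : Σ n : ℕ, Fin n → S.ι) : HasSum (fun k => (f k).1 a) (g a) :=
    hg.mapL (Koethe.coordL a ⟨0, S.fockWeight_pos β 0 a⟩)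
  have hg_symm : g ∈ S.testFunctions β := fun n σ J =>
    (hcoord _).unique ((hcoord _).congr_fun fun k => (f k).2 n σ J)
  refine ⟨⟨g, hg_symm⟩, (hasSum_iff_tendsto_seminorm fockWithSeminorms).2 fun p => ?_⟩
  refine ((hasSum_iff_tendsto_seminorm (Koethe.withSeminorms ℂ _)).1 hg p).congr fun s => ?_
  simp [fockNorms]

/-- The test function with given chaos coefficients. -/
def ofChaos (g : ∀ n, S.Tensor n) (hg : ∀ n, IsSymm (g n))
    (hs : ∀ p, Summable fun n => (n.factorial : ℝ) ^ (1 + β) * S.tensorNorms n p (g n) ^ 2) :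
    S.testFunctions β :=
  ⟨Koethe.mk (fun a => g a.1 a.2) fun p => by
    refine (summable_sigma_of_nonneg fun a => sq_nonneg _).2 ⟨fun n => ?_, ?_⟩
    · refine (((g n).summable p).mul_left ((n.factorial : ℝ) ^ (1 + β))).congr fun J => ?_
      exact (fockWeight_mul_sq p n J _).symm
    · refine (hs p).congr fun n => ?_
      rw [Koethe.norms_sq, ← tsum_mul_left]
      exact tsum_congr fun J => (fockWeight_mul_sq p n J _).symm,
  fun n σ J => isSymm_iff.1 (hg n) σ J⟩

@[simp] theorem chaos_ofChaos (g : ∀ n, S.Tensor n) (hg : ∀ n, IsSymm (g n))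
    (hs : ∀ p, Summable fun n => (n.factorial : ℝ) ^ (1 + β) * S.tensorNorms n p (g n) ^ 2)
    (n : ℕ) : chaos (ofChaos g hg hs) n = g n := rfl

/-! ### Homogeneous test functions -/

theorem IsSymm.single {f : S.Tensor n} (hf : IsSymm f) (m : ℕ) :
    IsSymm ((Pi.single n f : ∀ n, S.Tensor n) m) := by
  rcases eq_or_ne m n with rfl | h
  · rwa [Pi.single_eq_same]
  · rw [Pi.single_eq_of_ne h]
    exact isSymm_zero

theorem hasSum_tensorNorms_single_sq (n : ℕ) (f : S.Tensor n) (p : ℕ) :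
    HasSum (fun m => (m.factorial : ℝ) ^ (1 + β) *
      S.tensorNorms m p ((Pi.single n f : ∀ n, S.Tensor n) m) ^ 2)
      ((n.factorial : ℝ) ^ (1 + β) * S.tensorNorms n p f ^ 2) := by
  convert hasSum_single n fun m hm => ?_ using 1
  · rw [Pi.single_eq_same]
  · rw [Pi.single_eq_of_ne hm, map_zero]
    simp

/-- The test function `φ ∼ (0, …, 0, f, 0, …)` with the symmetric tensor `f` in degree `n`. -/
def ofSymm (β : ℝ) {f : S.Tensor n} (hf : IsSymm f) : S.testFunctions β :=
  ofChaos (Pi.single n f) hf.single fun p => (hasSum_tensorNorms_single_sq n f p).summable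

theorem fockNorms_ofSymm_sq {f : S.Tensor n} (hf : IsSymm f) (p : ℕ) :
    S.fockNorms β p (ofSymm β hf) ^ 2 = (n.factorial : ℝ) ^ (1 + β) * S.tensorNorms n p f ^ 2 :=
  (hasSum_fockNorms_sq p (ofSymm β hf)).unique (hasSum_tensorNorms_single_sq n f p)

theorem fockNorms_ofSymm_symPart_le (f : S.Tensor n) (p : ℕ) :
    S.fockNorms β p (ofSymm β (isSymm_symPart f)) ≤
      √((n.factorial : ℝ) ^ (1 + β)) * S.tensorNorms n p f := by
  refine (pow_le_pow_iff_left₀ (apply_nonneg _ _)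
    (mul_nonneg (Real.sqrt_nonneg _) (apply_nonneg _ _)) two_ne_zero).1 ?_
  rw [fockNorms_ofSymm_sq, mul_pow, Real.sq_sqrt (by positivity)]
  have := apply_nonneg (S.tensorNorms n p) (symPart n f)
  gcongr
  exact tensorNorms_symPart_le p f

variable (S β) in
/-- The embedding `f ↦ φ ∼ (0, …, 0, Sym f, 0, …)` of `E_ℂ^{⊗ n}` into `(E)_β`. It is defined on
all tensors, through their symmetrization, so that it is a linear map on a whole sequence space. -/
def homogeneous (n : ℕ) : S.Tensor n →L[ℂ] S.testFunctions β :=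
  let T : S.Tensor n →ₗ[ℂ] S.testFunctions β :=
    { toFun := fun f => ofSymm β (isSymm_symPart f)
      map_add' := fun f g => ext_chaos fun m => by
        simp only [ofSymm, map_add, Pi.single_add, chaos_ofChaos, chaos_add, Pi.add_apply]
      map_smul' := fun c f => ext_chaos fun m => by
        simp only [ofSymm, map_smul, Pi.single_smul, chaos_ofChaos, chaos_smul, Pi.smul_apply,
          RingHom.id_apply] }
  ⟨T, WithSeminorms.continuous_of_isBounded (Koethe.withSeminorms ℂ (S.weight n))
    fockWithSeminorms T <| Seminorm.IsBounded.of_real fun p => ⟨{p},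
      √((n.factorial : ℝ) ^ (1 + β)), fun f => by
      rw [Finset.sup_singleton]
      exact fockNorms_ofSymm_symPart_le f p⟩⟩

theorem chaos_homogeneous (n : ℕ) (f : S.Tensor n) (m : ℕ) :
    chaos (S.homogeneous β n f) m = (Pi.single n (symPart n f) : ∀ n, S.Tensor n) m := rfl

theorem chaos_homogeneous_self (n : ℕ) (f : S.Tensor n) :
    chaos (S.homogeneous β n f) n = symPart n f := by
  rw [chaos_homogeneous, Pi.single_eq_same]

theorem chaos_homogeneous_of_ne {m : ℕ} (h : m ≠ n) (f : S.Tensor n) :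
    chaos (S.homogeneous β n f) m = 0 := by
  rw [chaos_homogeneous, Pi.single_eq_of_ne h]

theorem homogeneous_permute (σ : Equiv.Perm (Fin n)) (f : S.Tensor n) :
    S.homogeneous β n (permute σ f) = S.homogeneous β n f := ext_chaos fun m => by
  rw [chaos_homogeneous, chaos_homogeneous, symPart_permute]

theorem fockNorms_homogeneous_chaos_le {c : ℝ} (hc : 0 < c) {p q : ℕ}
    (hgap : ∀ f : S.Tensor n, c ^ n * S.tensorNorms n p f ≤ S.tensorNorms n q f)
    (φ : S.testFunctions β) :
    S.fockNorms β p (S.homogeneous β n (chaos φ n)) ≤ c⁻¹ ^ n * S.fockNorms β q φ := by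
  refine fockNorms_le_of_chaos_le (d := 0) (by positivity) fun m => ?_
  rw [add_zero]
  rcases eq_or_ne m n with rfl | h
  · have hle : S.tensorNorms m p (chaos φ m) ≤ c⁻¹ ^ m * S.tensorNorms m q (chaos φ m) := by
      rw [inv_pow, ← div_eq_inv_mul, le_div_iff₀' (by positivity)]
      exact hgap _
    have := apply_nonneg (S.tensorNorms m p) (chaos φ m)
    rw [chaos_homogeneous_self, (isSymm_chaos φ m).symPart_eq, mul_left_comm, ← mul_pow]
    gcongr
  · rw [chaos_homogeneous_of_ne h, map_zero, zero_pow two_ne_zero, mul_zero]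
    positivity

theorem hasSum_homogeneous_chaos (φ : S.testFunctions β) :
    HasSum (fun n => S.homogeneous β n (chaos φ n)) φ := by
  obtain ⟨c, hc, hgap⟩ := S.exists_pow_mul_tensorNorms_le
  have hc0 : 0 < c := one_pos.trans hc
  obtain ⟨ψ, hψ⟩ := summable_of_summable_fockNorms fun p => Summable.of_nonneg_of_le
    (fun n => apply_nonneg _ _)
    (fun n => fockNorms_homogeneous_chaos_le (n := n) (p := p) (q := p + 1) hc0
      (fun f => by simpa using hgap n p 1 f) φ)
    ((summable_geometric_of_lt_one (by positivity) (inv_lt_one_of_one_lt₀ hc)).mul_right _)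
  have hψφ : ψ = φ := ext_chaos fun n => Koethe.ext fun J => by
    refine (hψ.mapL (chaosCoord n J)).unique ?_
    convert hasSum_single n fun m hm => ?_ using 1
    · rw [chaosCoord_apply, chaos_homogeneous_self, (isSymm_chaos φ n).symPart_eq]
    · rw [chaosCoord_apply, chaos_homogeneous_of_ne hm.symm, Koethe.zero_apply]
  rwa [hψφ] at hψ

end Eigenbasis

/-! ### Tensor powers and exponential vectors -/

theorem hasSum_pi_prod {𝕜 : Type*} [RCLike 𝕜] {γ : Type} {g : γ → 𝕜}
    (hg : Summable fun j => ‖g j‖) (n : ℕ) :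
    HasSum (fun J : Fin n → γ => ∏ i, g (J i)) ((∑' j, g j) ^ n) := by
  have hnorm (n : ℕ) : Summable fun J : Fin n → γ => ‖∏ i, g (J i)‖ :=
    (summable_pi_prod (fun j => norm_nonneg (g j)) hg n).congr fun J => (norm_prod _ _).symm
  suffices hsum : ∑' J : Fin n → γ, ∏ i, g (J i) = (∑' j, g j) ^ n from
    hsum ▸ (hnorm n).of_norm.hasSum
  induction n with
  | zero => simp [tsum_fintype]
  | succ n ih =>
    rw [← (Fin.consEquiv fun _ : Fin (n + 1) => γ).tsum_eq, pow_succ', ← ih,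
      tsum_mul_tsum_of_summable_norm hg (hnorm n)]
    refine tsum_congr fun x => ?_
    simp [Fin.prod_univ_succ, Fin.consEquiv]

theorem summable_pow_div_factorial_rpow {K : ℝ} (hK : 0 ≤ K) {δ : ℝ} (hδ : 0 < δ) :
    Summable fun n : ℕ => K ^ n / (n.factorial : ℝ) ^ δ := by
  rcases hK.eq_or_lt with rfl | hK
  · refine summable_of_ne_finset_zero (s := {0}) fun n hn => ?_
    rw [zero_pow (by simpa using hn), zero_div]
  have hfactorial (n : ℕ) : 0 < (n.factorial : ℝ) ^ δ :=
    Real.rpow_pos_of_pos (by exact_mod_cast n.factorial_pos) _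
  have hterm (n : ℕ) : 0 < K ^ n / (n.factorial : ℝ) ^ δ := div_pos (pow_pos hK n) (hfactorial n)
  refine summable_of_ratio_test_tendsto_lt_one one_pos
    (Filter.Eventually.of_forall fun n => (hterm n).ne') ?_
  have hratio : Filter.Tendsto (fun n : ℕ => K / ((n + 1 : ℕ) : ℝ) ^ δ) Filter.atTop (nhds 0) :=
    ((tendsto_rpow_atTop hδ).comp
      (tendsto_natCast_atTop_atTop.comp (Filter.tendsto_add_atTop_nat 1))).const_div_atTop K
  refine hratio.congr fun n => ?_
  have := hfactorial n
  have : 0 < ((n + 1 : ℕ) : ℝ) ^ δ := Real.rpow_pos_of_pos (by positivity) _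
  rw [Real.norm_of_nonneg (hterm _).le, Real.norm_of_nonneg (hterm _).le, Nat.factorial_succ,
    Nat.cast_mul, Real.mul_rpow (by positivity) (by positivity), pow_succ]
  field_simp

namespace Eigenbasis

variable {A : RealL2 →ₗ.[ℝ] RealL2} {S : Eigenbasis A} {β : ℝ} {n : ℕ}

variable (S) in
/-- The complexification `E_ℂ`; `z j` is the coordinate of `z` at `eⱼ`. -/
abbrev ComplexTestSpace : Type := Koethe ℂ fun p j => S.lam j ^ p

theorem weight_mul_norm_prod_sq (z : S.ι → ℂ) (n p : ℕ) (J : Fin n → S.ι) :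
    (S.weight n p J * ‖∏ i, z (J i)‖) ^ 2 = ∏ i, (S.lam (J i) ^ p * ‖z (J i)‖) ^ 2 := by
  rw [weight, norm_prod, ← Finset.prod_mul_distrib, Finset.prod_pow]

/-- The tensor power `z^{⊗ n}` of `z ∈ E_ℂ`. -/
def vecPow (z : S.ComplexTestSpace) (n : ℕ) : S.Tensor n :=
  Koethe.mk (fun J => ∏ i, z (J i)) fun p =>
    (summable_pi_prod (fun _ => sq_nonneg _) (z.summable p) n).congr fun J =>
      (weight_mul_norm_prod_sq z n p J).symm

@[simp] theorem vecPow_apply (z : S.ComplexTestSpace) (n : ℕ) (J : Fin n → S.ι) :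
    vecPow z n J = ∏ i, z (J i) := rfl

theorem vecPow_smul (s : ℂ) (z : S.ComplexTestSpace) (n : ℕ) :
    vecPow (s • z) n = s ^ n • vecPow z n :=
  Koethe.ext fun J => by simp [Finset.prod_mul_distrib]

theorem isSymm_vecPow (z : S.ComplexTestSpace) (n : ℕ) : IsSymm (vecPow z n) :=
  isSymm_iff.2 fun σ J => Equiv.prod_comp σ fun i => z (J i)

theorem tensorNorms_vecPow (z : S.ComplexTestSpace) (n p : ℕ) :
    S.tensorNorms n p (vecPow z n) = Koethe.norms ℂ _ p z ^ n := by
  refine (pow_left_inj₀ (apply_nonneg _ _) (pow_nonneg (apply_nonneg _ _) n) two_ne_zero).1 ?_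
  rw [pow_right_comm, Koethe.norms_sq, Koethe.norms_sq,
    ← (hasSum_pi_prod (z.summable p).norm n).tsum_eq]
  exact tsum_congr fun J => weight_mul_norm_prod_sq z n p J

theorem contract_vecPow {a b : ℕ} (h : a + b = n) (κ : S.Dual b) (z : S.ComplexTestSpace) :
    contract h κ (vecPow z n) = κ (vecPow z b) • vecPow z a := by
  subst h
  refine Koethe.ext fun J => ?_
  have hslice : slice rfl (vecPow z (a + b)) J = vecPow z a J • vecPow z b :=
    Koethe.ext fun K =>
      (Fin.prod_univ_add fun i => z (Fin.append J K i)).trans (by simp)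
  calc κ (slice rfl (vecPow z (a + b)) J) = vecPow z a J * κ (vecPow z b) := by
        rw [hslice, map_smul, smul_eq_mul]
    _ = (κ (vecPow z b) • vecPow z a) J := mul_comm _ _

theorem tensor_vecPow {a b : ℕ} (h : a + b = n) (κ₁ : S.Dual a) (κ₂ : S.Dual b)
    (z : S.ComplexTestSpace) :
    tensor h κ₁ κ₂ (vecPow z n) = κ₁ (vecPow z a) * κ₂ (vecPow z b) := by
  rw [tensor, ContinuousLinearMap.comp_apply, contract_vecPow, map_smul, smul_eq_mul, mul_comm]

theorem symmetrize_apply (κ : S.Dual n) (f : S.Tensor n) : symmetrize κ f = κ (symPart n f) := by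
  simp [symmetrize, symPart]

theorem symmetrize_vecPow (κ : S.Dual n) (z : S.ComplexTestSpace) :
    symmetrize κ (vecPow z n) = κ (vecPow z n) := by
  rw [symmetrize_apply, (isSymm_vecPow z n).symPart_eq]

theorem isSymmDual_symmetrize (κ : S.Dual n) : IsSymmDual (symmetrize κ) := fun σ f => by
  rw [symmetrize_apply, symmetrize_apply, symPart_permute]

theorem tensorPow_vecPow {r : ℕ} (κ : S.Dual r) (k : ℕ) (z : S.ComplexTestSpace) :
    tensorPow κ k (vecPow z (r * k)) = κ (vecPow z r) ^ k := by
  induction k with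
  | zero =>
    have hone : tensorPow κ 0 (vecPow z (r * 0)) = ∑' J : Fin 0 → S.ι, 1 * ∏ i, z (J i) := rfl
    rw [hone, tsum_fintype]
    simp
  | succ k ih => rw [tensorPow, tensor_vecPow, ih, pow_succ]

theorem factorial_rpow_mul_tensorNorms_vecPow_sq (z : S.ComplexTestSpace) (n p : ℕ) :
    (n.factorial : ℝ) ^ (1 + β) * S.tensorNorms n p ((n.factorial : ℂ)⁻¹ • vecPow z n) ^ 2 =
      (Koethe.norms ℂ _ p z ^ 2) ^ n / (n.factorial : ℝ) ^ (1 - β) := by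
  have hn : (0 : ℝ) < n.factorial := by exact_mod_cast n.factorial_pos
  have hexp : (n.factorial : ℝ) ^ (1 + β) * (n.factorial : ℝ) ^ (1 - β) =
      (n.factorial : ℝ) ^ 2 := by
    rw [← Real.rpow_add hn, ← Real.rpow_natCast]
    congr 1
    push_cast
    ring
  have := Real.rpow_pos_of_pos hn (1 - β)
  rw [map_smul_eq_mul, tensorNorms_vecPow, norm_inv, Complex.norm_natCast, eq_div_iff this.ne',
    mul_right_comm, hexp, pow_right_comm]
  field_simp

/-- The exponential vector `Φ_z ∼ (z^{⊗ n} / n!)`. -/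
def expVec (hβ : β < 1) (z : S.ComplexTestSpace) : S.testFunctions β :=
  ofChaos (fun n => (n.factorial : ℂ)⁻¹ • vecPow z n)
    (fun n σ => by rw [map_smul, isSymm_vecPow z n σ]) fun p =>
    (summable_pow_div_factorial_rpow (sq_nonneg (Koethe.norms ℂ _ p z)) (sub_pos.2 hβ)).congr
      fun n => (factorial_rpow_mul_tensorNorms_vecPow_sq z n p).symm

@[simp] theorem chaos_expVec (hβ : β < 1) (z : S.ComplexTestSpace) (n : ℕ) :
    chaos (expVec hβ z) n = (n.factorial : ℂ)⁻¹ • vecPow z n := rfl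

end Eigenbasis

/-! ### Totality of the exponential vectors -/

theorem exists_perm_of_sum_single_eq {γ : Type*} {n : ℕ} {J K : Fin n → γ}
    (h : ∑ i, Finsupp.single (J i) 1 = ∑ i, Finsupp.single (K i) (1 : ℕ)) :
    ∃ σ : Equiv.Perm (Fin n), J = K ∘ σ := by
  classical
  have hcount (I : Fin n → γ) (c : γ) :
      (∑ i, Finsupp.single (I i) (1 : ℕ)) c = Fintype.card {i // I i = c} := by
    rw [Finsupp.finsetSum_apply, Fintype.card_subtype, Finset.card_filter]
    exact Finset.sum_congr rfl fun i _ => Finsupp.single_apply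
  have hfiber (c : γ) : Nonempty ({i // J i = c} ≃ {i // K i = c}) := by
    rw [← Fintype.card_eq, ← hcount, ← hcount, h]
  exact ⟨Equiv.ofFiberEquiv fun c => (hfiber c).some,
    funext fun i => (Equiv.ofFiberEquiv_map (fun c => (hfiber c).some) i).symm⟩

section SymmetricForms

open MvPolynomial

variable {R γ : Type*} [CommSemiring R] [Fintype γ] {n : ℕ}

theorem eval_sum_monomial (c : (Fin n → γ) → R) (x : γ → R) :
    eval x (∑ J, monomial (∑ i, Finsupp.single (J i) 1) (c J)) = ∑ J, c J * ∏ i, x (J i) := by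
  rw [map_sum]
  refine Finset.sum_congr rfl fun J _ => ?_
  rw [eval_monomial,
    ← Finsupp.prod_finsetSum_index (fun _ => pow_zero _) fun _ _ _ => pow_add _ _ _]
  simp

theorem coeff_sum_monomial_of_symmetric [DecidableEq γ] {c : (Fin n → γ) → R}
    (hc : ∀ (σ : Equiv.Perm (Fin n)) (J : Fin n → γ), c (J ∘ σ) = c J) (K : Fin n → γ) :
    coeff (∑ i, Finsupp.single (K i) 1) (∑ J, monomial (∑ i, Finsupp.single (J i) 1) (c J)) =
      (Finset.univ.filter fun J : Fin n → γ =>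
        ∑ i, Finsupp.single (J i) 1 = ∑ i, Finsupp.single (K i) 1).card * c K := by
  rw [coeff_sum, ← nsmul_eq_mul, ← Finset.sum_const, Finset.sum_filter]
  refine Finset.sum_congr rfl fun J _ => ?_
  rw [coeff_monomial]
  split_ifs with hJ
  · obtain ⟨σ, rfl⟩ := exists_perm_of_sum_single_eq hJ
    exact hc σ K
  · rfl

end SymmetricForms

theorem eq_zero_of_symmetric_form_eq_zero {R γ : Type*} [CommRing R] [IsDomain R] [CharZero R]
    [Fintype γ] {n : ℕ} {s : Set R} (hs : s.Infinite) {c : (Fin n → γ) → R}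
    (hc : ∀ (σ : Equiv.Perm (Fin n)) (J : Fin n → γ), c (J ∘ σ) = c J)
    (h : ∀ x : γ → R, (∀ j, x j ∈ s) → ∑ J, c J * ∏ i, x (J i) = 0) : c = 0 := by
  classical
  have hzero : ∑ J, MvPolynomial.monomial (∑ i, Finsupp.single (J i) 1) (c J) = 0 :=
    MvPolynomial.funext_set (fun _ => s) (fun _ => hs) fun x hx => by
      rw [eval_sum_monomial, h x fun j => hx j (Set.mem_univ j), map_zero]
  funext K
  have hcoeff := coeff_sum_monomial_of_symmetric hc K
  rw [hzero, MvPolynomial.coeff_zero] at hcoeff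
  refine (mul_eq_zero.1 hcoeff.symm).resolve_left ?_
  exact_mod_cast Finset.card_ne_zero.2 ⟨K, by simp⟩

theorem eq_zero_of_hasSum_symmetric_form {γ : Type*} {n : ℕ} {c : (Fin n → γ) → ℂ}
    (hc : ∀ (σ : Equiv.Perm (Fin n)) (J : Fin n → γ), c (J ∘ σ) = c J)
    (h : ∀ t : γ →₀ ℝ, HasSum (fun J => c J * ∏ i, (t (J i) : ℂ)) 0) : c = 0 := by
  classical
  funext K
  let F := Finset.univ.image K
  suffices hF : (fun J : Fin n → F => c fun i => J i) = 0 from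
    congrFun hF fun i => ⟨K i, Finset.mem_image_of_mem K (Finset.mem_univ i)⟩
  refine eq_zero_of_symmetric_form_eq_zero
    (Set.infinite_range_of_injective Complex.ofReal_injective)
    (fun σ J => hc σ fun i => J i) fun x hx => ?_
  choose t ht using hx
  let t' : γ →₀ ℝ := Finsupp.onFinset F (fun j => if hj : j ∈ F then t ⟨j, hj⟩ else 0)
    fun j hj => by
      by_contra hF
      exact hj (dif_neg hF)
  have ht' (j : F) : (t' j : ℂ) = x j := (congrArg _ (dif_pos j.2)).trans (ht j)
  have hinj : Function.Injective fun (J : Fin n → F) (i : Fin n) => (J i : γ) :=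
    fun J J' hJ => funext fun i => Subtype.ext (congrFun hJ i)
  have hsupport (J : Fin n → γ) (hJ : J ∉ Set.range fun (J : Fin n → F) i => (J i : γ)) :
      c J * ∏ i, (t' (J i) : ℂ) = 0 := by
    obtain ⟨i, hi⟩ : ∃ i, J i ∉ F := by
      by_contra! hF
      exact hJ ⟨fun i => ⟨J i, hF i⟩, rfl⟩
    have : t' (J i) = 0 := dif_neg hi
    rw [Finset.prod_eq_zero (Finset.mem_univ i) (by rw [this, Complex.ofReal_zero]), mul_zero]
  refine (hasSum_fintype _).unique (((hinj.hasSum_iff hsupport).2 (h t')).congr_fun fun J => ?_)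
  simp only [Function.comp_apply, ht']

theorem eq_zero_of_hasSum_pow_smul {𝕜 V : Type*} [NontriviallyNormedField 𝕜]
    [NormedAddCommGroup V] [NormedSpace 𝕜 V] {a : ℕ → V}
    (h : ∀ s : 𝕜, HasSum (fun n => s ^ n • a n) 0) : a = 0 := by
  let P : FormalMultilinearSeries 𝕜 𝕜 V := fun n =>
    ContinuousMultilinearMap.mkPiRing 𝕜 (Fin n) (a n)
  have hcoeff (n : ℕ) : P.coeff n = a n := by simp [P, FormalMultilinearSeries.coeff]
  have hP : HasFPowerSeriesAt (0 : 𝕜 → V) P 0 :=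
    hasFPowerSeriesAt_iff.2 (Filter.Eventually.of_forall fun s => by simpa [hcoeff] using h s)
  funext n
  rw [← hcoeff, hP.eq_zero]
  simp [FormalMultilinearSeries.coeff]

namespace Eigenbasis

variable {A : RealL2 →ₗ.[ℝ] RealL2} {S : Eigenbasis A} {β : ℝ} {n : ℕ}

variable (S) in
/-- A finitely supported real sequence of coordinates, as an element of `E_ℂ`. -/
def finVec (t : S.ι →₀ ℝ) : S.ComplexTestSpace :=
  Koethe.mk (fun j => (t j : ℂ)) fun p =>
    summable_of_ne_finset_zero (s := t.support) fun j hj => by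
      rw [Finsupp.notMem_support_iff.1 hj]
      simp

@[simp] theorem finVec_apply (t : S.ι →₀ ℝ) (j : S.ι) : S.finVec t j = (t j : ℂ) := rfl

theorem finVec_smul (s : ℝ) (t : S.ι →₀ ℝ) : S.finVec (s • t) = (s : ℂ) • S.finVec t :=
  Koethe.ext fun j => Complex.ofReal_mul s (t j)

theorem permute_delta [DecidableEq S.ι] (σ : Equiv.Perm (Fin n)) (J : Fin n → S.ι) :
    permute σ (Koethe.delta (J ∘ σ) : S.Tensor n) = Koethe.delta J := Koethe.ext fun I => by
  change (Koethe.delta (J ∘ σ) : S.Tensor n) (I ∘ σ) = _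
  simp only [Koethe.delta_apply, Pi.single_apply, σ.surjective.right_cancellable]

theorem IsSymmDual.ext {L M : S.Dual n} (hL : IsSymmDual L) (hM : IsSymmDual M)
    (h : ∀ t, L (vecPow (S.finVec t) n) = M (vecPow (S.finVec t) n)) : L = M := by
  classical
  have hcoeff : (fun J => (L - M) (Koethe.delta J)) = 0 := by
    refine eq_zero_of_hasSum_symmetric_form (fun σ J => ?_) fun t => ?_
    · simp only [sub_apply]
      rw [← hL σ, ← hM σ, permute_delta]
    · have hsum := (Koethe.hasSum_smul_delta (vecPow (S.finVec t) n)).mapL (L - M)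
      rw [sub_apply, h, sub_self] at hsum
      refine hsum.congr_fun fun J => ?_
      rw [map_smul, smul_eq_mul, mul_comm]
      rfl
  exact Koethe.clm_ext fun J => sub_eq_zero.1 (congrFun hcoeff J)

theorem functional_ext_expVec (hβ : β < 1) {l m : S.testFunctions β →L[ℂ] ℂ}
    (h : ∀ t, l (expVec hβ (S.finVec t)) = m (expVec hβ (S.finVec t))) : l = m := by
  have hpow (t : S.ι →₀ ℝ) : (fun n => (n.factorial : ℂ)⁻¹ *
      (l - m) (S.homogeneous β n (vecPow (S.finVec t) n))) = 0 := by
    refine eq_zero_of_hasSum_pow_smul fun s : ℝ => ?_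
    have hsum := (hasSum_homogeneous_chaos (expVec hβ (S.finVec (s • t)))).mapL (l - m)
    rw [sub_apply, h, sub_self] at hsum
    refine hsum.congr_fun fun n => ?_
    rw [chaos_expVec, finVec_smul, vecPow_smul]
    simp only [map_smul, smul_eq_mul, Complex.real_smul, Complex.ofReal_pow]
    ring
  have hhomogeneous (n : ℕ) : l.comp (S.homogeneous β n) = m.comp (S.homogeneous β n) := by
    refine IsSymmDual.ext (fun σ f => ?_) (fun σ f => ?_) fun t => ?_
    · simp only [ContinuousLinearMap.comp_apply, homogeneous_permute]
    · simp only [ContinuousLinearMap.comp_apply, homogeneous_permute]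
    · have hn : ((n.factorial : ℂ)⁻¹) ≠ 0 := inv_ne_zero (by exact_mod_cast n.factorial_ne_zero)
      exact sub_eq_zero.1 ((mul_eq_zero.1 (congrFun (hpow t) n)).resolve_left hn)
  ext φ
  exact ((hasSum_homogeneous_chaos φ).mapL l).unique
    (((hasSum_homogeneous_chaos φ).mapL m).congr_fun fun n =>
      DFunLike.congr_fun (hhomogeneous n) (chaos φ n))

theorem operator_ext_expVec (hβ : β < 1) {T U : S.testFunctions β →L[ℂ] S.testFunctions β}
    (h : ∀ t, T (expVec hβ (S.finVec t)) = U (expVec hβ (S.finVec t))) : T = U := by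
  ext1 φ
  refine ext_chaos fun n => Koethe.ext fun J => ?_
  have hcoord : (chaosCoord n J).comp T = (chaosCoord n J).comp U :=
    functional_ext_expVec hβ fun t => by simp only [ContinuousLinearMap.comp_apply, h]
  exact DFunLike.congr_fun hcoord φ

end Eigenbasis

/-! ### Power series on `E*` -/

namespace Eigenbasis

variable {A : RealL2 →ₗ.[ℝ] RealL2} {S : Eigenbasis A} {β : ℝ} {n : ℕ}

theorem exists_summable_dual_coords (x : S.DualSpace) :
    ∃ p, Summable fun j => ((S.lam j ^ p)⁻¹ * ‖(x (S.basisVec j) : ℂ)‖) ^ 2 := by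
  obtain ⟨p, -, hp⟩ := summable_pointPow x 1
  refine ⟨p, ((Equiv.funUnique (Fin 1) S.ι).symm.summable_iff.2 hp).congr fun j => ?_⟩
  simp [weight]

theorem fockWeight_inv_mul_norm_prod_sq (y : S.ι → ℂ) (p : ℕ) (J : Fin n → S.ι) :
    ((S.fockWeight β p ⟨n, J⟩)⁻¹ * ‖∏ i, y (J i)‖) ^ 2 =
      ((n.factorial : ℝ) ^ (1 + β))⁻¹ * ∏ i, ((S.lam (J i) ^ p)⁻¹ * ‖y (J i)‖) ^ 2 := by
  have hfactorial : ((n.factorial : ℝ) ^ ((1 + β) / 2)) ^ 2 = (n.factorial : ℝ) ^ (1 + β) := by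
    rw [← Real.rpow_mul_natCast (Nat.cast_nonneg _)]
    norm_num
  rw [fockWeight, mul_inv, mul_assoc, mul_pow, inv_pow, hfactorial, weight, norm_prod,
    ← Finset.prod_inv_distrib, ← Finset.prod_mul_distrib, Finset.prod_pow]

theorem exists_summable_fock_dual (hβ : 0 ≤ β) (x : S.DualSpace) :
    ∃ p, (∀ a, 0 < S.fockWeight β p a) ∧ Summable fun a : Σ n : ℕ, Fin n → S.ι =>
      ((S.fockWeight β p a)⁻¹ * ‖∏ i, (x (S.basisVec (a.2 i)) : ℂ)‖) ^ 2 := by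
  obtain ⟨p, hp⟩ := exists_summable_dual_coords x
  set K := ∑' j, ((S.lam j ^ p)⁻¹ * ‖(x (S.basisVec j) : ℂ)‖) ^ 2
  have hlevel (n : ℕ) : HasSum (fun J : Fin n → S.ι =>
      ((S.fockWeight β p ⟨n, J⟩)⁻¹ * ‖∏ i, (x (S.basisVec (J i)) : ℂ)‖) ^ 2)
      (K ^ n / (n.factorial : ℝ) ^ (1 + β)) := by
    rw [div_eq_inv_mul]
    exact ((hasSum_pi_prod hp.norm n).mul_left _).congr_fun
      fun J => fockWeight_inv_mul_norm_prod_sq (fun j => (x (S.basisVec j) : ℂ)) p J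
  have hfactorial : Summable fun n : ℕ => K ^ n / (n.factorial : ℝ) ^ (1 + β) :=
    summable_pow_div_factorial_rpow (tsum_nonneg fun _ => sq_nonneg _) (by linarith)
  refine ⟨p, S.fockWeight_pos β p, (summable_sigma_of_nonneg fun a => sq_nonneg _).2
    ⟨fun n => (hlevel n).summable, hfactorial.congr fun n => (hlevel n).tsum_eq.symm⟩⟩

/-- The functional `φ ↦ ∑ₙ ⟨x^{⊗ n}, fₙ⟩` on `(E)_β`. The tensor powers are not Wick ordered, so
this is not the value at `x` of the function represented by `φ`. -/
def pointEval (hβ : 0 ≤ β) (x : S.DualSpace) : S.testFunctions β →L[ℂ] ℂ :=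
  (Koethe.pairing (fun a : Σ n : ℕ, Fin n → S.ι => ∏ i, (x (S.basisVec (a.2 i)) : ℂ))
    (exists_summable_fock_dual hβ x)).comp (S.testFunctions β).subtypeL

theorem hasSum_pointPow (x : S.DualSpace) (f : S.Tensor n) :
    HasSum (fun J => (∏ i, (x (S.basisVec (J i)) : ℂ)) * f J) (pointPow x n f) := by
  obtain ⟨p, hw, hp⟩ := summable_pointPow x n
  exact (Koethe.pairing_aux hw hp f).1.hasSum

theorem pointPow_smul (s : ℝ) (x : S.DualSpace) (f : S.Tensor n) :
    pointPow (s • x) n f = (s : ℂ) ^ n * pointPow x n f := by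
  refine (hasSum_pointPow (s • x) f).unique
    (((hasSum_pointPow x f).mul_left ((s : ℂ) ^ n)).congr_fun fun J => ?_)
  simp [Finset.prod_mul_distrib, mul_assoc]

theorem pointEval_homogeneous (hβ : 0 ≤ β) (x : S.DualSpace) {f : S.Tensor n} (hf : IsSymm f) :
    pointEval hβ x (S.homogeneous β n f) = pointPow x n f := by
  have hpairing : pointEval hβ x (S.homogeneous β n f) = ∑' a : Σ n : ℕ, Fin n → S.ι,
      (∏ i, (x (S.basisVec (a.2 i)) : ℂ)) * chaos (S.homogeneous β n f) a.1 a.2 := rfl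
  rw [hpairing, ← (sigma_mk_injective (i := n)).tsum_eq]
  · refine Eq.trans (tsum_congr fun J => ?_) (hasSum_pointPow x f).tsum_eq
    rw [chaos_homogeneous_self, hf.symPart_eq]
  · rintro ⟨m, J⟩ hm
    rcases eq_or_ne m n with rfl | h
    · exact ⟨J, rfl⟩
    · refine absurd ?_ hm
      simp only
      rw [chaos_homogeneous_of_ne h, Koethe.zero_apply, mul_zero]

theorem hasSum_pointEval (hβ : 0 ≤ β) (x : S.DualSpace) (φ : S.testFunctions β) :
    HasSum (fun n => pointPow x n (chaos φ n)) (pointEval hβ x φ) :=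
  ((hasSum_homogeneous_chaos φ).mapL (pointEval hβ x)).congr_fun fun n =>
    (pointEval_homogeneous hβ x (isSymm_chaos φ n)).symm

/-- The pairing `⟨x, z⟩` of `x ∈ E*` with `z ∈ E_ℂ`. -/
def dualPair (x : S.DualSpace) (z : S.ComplexTestSpace) : ℂ :=
  ∑' j, (x (S.basisVec j) : ℂ) * z j

theorem pointPow_vecPow (x : S.DualSpace) (n : ℕ) (z : S.ComplexTestSpace) :
    pointPow x n (vecPow z n) = dualPair x z ^ n := by
  obtain ⟨p, hp⟩ := exists_summable_dual_coords x
  have hsummable : Summable fun j => (x (S.basisVec j) : ℂ) * z j :=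
    (Koethe.pairing_aux (w := fun p j => S.lam j ^ p)
      (fun j => pow_pos (one_pos.trans_le (S.one_le j)) p) hp z).1
  refine (hasSum_pointPow x _).unique ((hasSum_pi_prod hsummable.norm n).congr_fun fun J => ?_)
  rw [vecPow_apply, ← Finset.prod_mul_distrib]

theorem pointEval_expVec (hβ : 0 ≤ β) (hβ' : β < 1) (x : S.DualSpace) (z : S.ComplexTestSpace) :
    pointEval hβ x (expVec hβ' z) = Complex.exp (dualPair x z) := by
  refine (hasSum_pointEval hβ x (expVec hβ' z)).unique ?_
  rw [Complex.exp_eq_exp_ℂ]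
  refine (NormedSpace.expSeries_div_hasSum_exp (dualPair x z)).congr_fun fun n => ?_
  rw [chaos_expVec, map_smul, pointPow_vecPow, smul_eq_mul, div_eq_inv_mul]

theorem coords_basisVec [DecidableEq S.ι] (j : S.ι) : S.coords (S.basisVec j) = Koethe.delta j :=
  Koethe.ext fun i => by
    rw [coords_apply, toL2_basisVec, Koethe.delta_apply, Pi.single_apply]
    exact orthonormal_iff_ite.1 S.e.orthonormal i j

variable (S) in
theorem isInducing_coords : Topology.IsInducing S.coords := by
  have hinduced := S.coords.withSeminorms_induced (Koethe.withSeminorms ℝ fun p j => S.lam j ^ p)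
  exact ⟨@WithSeminorms.topology_eq_withSeminorms _ _ _ _ _ _ _ (_) hinduced ▸ rfl⟩

theorem hasSum_basisVec (ξ : S.TestSpace) :
    HasSum (fun j => S.coords ξ j • S.basisVec j) ξ := by
  classical
  refine (S.isInducing_coords.hasSum_iff _ _).1 ?_
  simpa [Function.comp_def, coords_basisVec] using Koethe.hasSum_smul_delta (S.coords ξ)

/-- The vector `ξ + i η ∈ E_ℂ`. -/
def complexVec (ξ η : S.TestSpace) : S.ComplexTestSpace :=
  Koethe.mk (fun j => (S.coords ξ j : ℂ) + Complex.I * (S.coords η j : ℂ)) <| by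
    have hreal (ξ : S.TestSpace) : (fun j => (S.coords ξ j : ℂ)) ∈
        koetheSubmodule ℂ fun p j => S.lam j ^ p := fun p =>
      ((S.coords ξ).summable p).congr fun j => by rw [Complex.norm_real]
    exact Submodule.add_mem _ (hreal ξ) (Submodule.smul_mem _ Complex.I (hreal η))

theorem dualPair_complexVec (x : S.DualSpace) (ξ η : S.TestSpace) :
    dualPair x (complexVec ξ η) = (x ξ : ℂ) + Complex.I * (x η : ℂ) := by
  have hreal (ξ : S.TestSpace) :
      HasSum (fun j => (x (S.basisVec j) : ℂ) * (S.coords ξ j : ℂ)) (x ξ : ℂ) := by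
    refine (Complex.hasSum_ofReal.2 ((hasSum_basisVec ξ).mapL x)).congr_fun fun j => ?_
    rw [map_smul, smul_eq_mul, Complex.ofReal_mul, mul_comm]
  refine (((hreal ξ).add ((hreal η).mul_left Complex.I)).congr_fun fun j => ?_).tsum_eq
  rw [mul_left_comm, ← mul_add]
  rfl

theorem isExpVector_iff (hβ : β < 1) {ψ : S.testFunctions β} {ξ η : S.TestSpace} :
    IsExpVector ψ ξ η ↔ ψ = expVec hβ (complexVec ξ η) :=
  ⟨fun h => ext_chaos fun n => Koethe.ext fun J => h n J, fun h n J => by rw [h]; rfl⟩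

theorem exists_complexVec_eq_finVec (t : S.ι →₀ ℝ) : ∃ ξ, complexVec ξ 0 = S.finVec t := by
  classical
  refine ⟨∑ j ∈ t.support, t j • S.basisVec j, Koethe.ext fun i => ?_⟩
  have hcoords : S.coords (∑ j ∈ t.support, t j • S.basisVec j) i = t i := by
    simp only [map_sum, map_smul, coords_basisVec, Koethe.sum_smul_delta_apply]
    simp [eq_comm]
  change (S.coords _ i : ℂ) + Complex.I * (S.coords (0 : S.TestSpace) i : ℂ) = _
  rw [hcoords, map_zero, Koethe.zero_apply, Complex.ofReal_zero, mul_zero, add_zero, finVec_apply]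

theorem exists_dual_apply_basisVec (t : S.ι →₀ ℝ) :
    ∃ x : S.DualSpace, ∀ j, x (S.basisVec j) = t j := by
  classical
  let coordsL : S.TestSpace →L[ℝ] Koethe ℝ fun p j => S.lam j ^ p :=
    ⟨S.coords, S.isInducing_coords.continuous⟩
  have hweight (j : S.ι) : ∃ p : ℕ, 0 < S.lam j ^ p := ⟨0, by simp⟩
  refine ⟨∑ j ∈ t.support, t j • (Koethe.coordL j (hweight j)).comp coordsL, fun i => ?_⟩
  have hcoord (j : S.ι) : (Koethe.coordL j (hweight j)).comp coordsL (S.basisVec i) =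
      (Pi.single i 1 : S.ι → ℝ) j := by
    rw [← Koethe.delta_apply (w := fun p j => S.lam j ^ p), ← coords_basisVec]
    rfl
  simp only [sum_apply, smul_apply, hcoord, Pi.single_apply]
  simp [eq_comm]

theorem eq_zero_of_pointEval_eq_zero (hβ : 0 ≤ β) {φ : S.testFunctions β}
    (h : ∀ x, pointEval hβ x φ = 0) : φ = 0 := by
  have hpow (x : S.DualSpace) : (fun n => pointPow x n (chaos φ n)) = 0 := by
    refine eq_zero_of_hasSum_pow_smul fun s : ℝ => ?_
    rw [← h (s • x)]
    refine (hasSum_pointEval hβ (s • x) φ).congr_fun fun n => ?_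
    rw [pointPow_smul, Complex.real_smul, Complex.ofReal_pow]
  refine ext_chaos fun n => Koethe.ext (congrFun (eq_zero_of_hasSum_symmetric_form
    (isSymm_iff.1 (isSymm_chaos φ n)) fun t => ?_))
  obtain ⟨x, hx⟩ := exists_dual_apply_basisVec t
  rw [← show pointPow x n (chaos φ n) = 0 from congrFun (hpow x) n]
  refine (hasSum_pointPow x (chaos φ n)).congr_fun fun J => ?_
  simp only [hx, mul_comm]

theorem ext_pointEval (hβ : 0 ≤ β) {φ ψ : S.testFunctions β}
    (h : ∀ x, pointEval hβ x φ = pointEval hβ x ψ) : φ = ψ :=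
  sub_eq_zero.1 (eq_zero_of_pointEval_eq_zero hβ fun x => by rw [map_sub, h, sub_self])

end Eigenbasis

/-! ### Integral kernel operators and their exponentials -/

theorem factorial_mul_le (r k : ℕ) : (r * k).factorial ≤ 2 ^ (r ^ 2 * k) * k.factorial ^ r := by
  induction r with
  | zero => simp
  | succ r ih =>
    have hchoose : (r * k + k).choose k ≤ 2 ^ (r * k + k) := Nat.choose_le_two_pow _ _
    have hexponent : r * k + k + r ^ 2 * k ≤ (r + 1) ^ 2 * k := by nlinarith
    calc ((r + 1) * k).factorial
        = (r * k + k).choose k * (r * k).factorial * k.factorial := by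
          rw [Nat.add_mul, one_mul, Nat.add_choose_mul_factorial_mul_factorial]
      _ ≤ 2 ^ (r * k + k) * (2 ^ (r ^ 2 * k) * k.factorial ^ r) * k.factorial := by gcongr
      _ = 2 ^ (r * k + k + r ^ 2 * k) * k.factorial ^ (r + 1) := by ring
      _ ≤ 2 ^ ((r + 1) ^ 2 * k) * k.factorial ^ (r + 1) := by
          gcongr
          exact one_le_two

theorem factorial_add_mul_le (n r k : ℕ) : (n + r * k).factorial ≤
    2 ^ (n + r * k) * 2 ^ (r ^ 2 * k) * k.factorial ^ r * n.factorial := by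
  have hchoose : (n + r * k).choose (r * k) ≤ 2 ^ (n + r * k) := Nat.choose_le_two_pow _ _
  calc (n + r * k).factorial
      = (n + r * k).choose (r * k) * n.factorial * (r * k).factorial :=
        (Nat.add_choose_mul_factorial_mul_factorial n (r * k)).symm
    _ ≤ 2 ^ (n + r * k) * n.factorial * (2 ^ (r ^ 2 * k) * k.factorial ^ r) := by
        gcongr
        exact factorial_mul_le r k
    _ = 2 ^ (n + r * k) * 2 ^ (r ^ 2 * k) * k.factorial ^ r * n.factorial := by ring

theorem factorial_ratio_rpow_le {r : ℕ} {δ : ℝ} (hδ : 0 ≤ δ) (hδ' : δ ≤ 1) (hrδ : r * δ ≤ 2)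
    (n k : ℕ) : (((n + r * k).factorial : ℝ) / n.factorial) ^ δ ≤
      2 ^ (n + r * k) * 2 ^ (r ^ 2 * k) * (k.factorial : ℝ) ^ 2 := by
  have hk : (1 : ℝ) ≤ k.factorial := by exact_mod_cast k.factorial_pos
  have hratio : ((n + r * k).factorial : ℝ) / n.factorial ≤
      2 ^ (n + r * k) * 2 ^ (r ^ 2 * k) * (k.factorial : ℝ) ^ r := by
    rw [div_le_iff₀ (by exact_mod_cast n.factorial_pos)]
    exact_mod_cast factorial_add_mul_le n r k
  have hbase : (1 : ℝ) ≤ 2 ^ (n + r * k) * 2 ^ (r ^ 2 * k) := by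
    rw [← pow_add]
    exact one_le_pow₀ one_le_two
  calc (((n + r * k).factorial : ℝ) / n.factorial) ^ δ
      ≤ (2 ^ (n + r * k) * 2 ^ (r ^ 2 * k) * (k.factorial : ℝ) ^ r) ^ δ := by gcongr
    _ = (2 ^ (n + r * k) * 2 ^ (r ^ 2 * k)) ^ δ * (k.factorial : ℝ) ^ (r * δ) := by
        rw [Real.mul_rpow (by positivity) (by positivity), ← Real.rpow_natCast (k.factorial : ℝ),
          ← Real.rpow_mul (by positivity)]
    _ ≤ (2 ^ (n + r * k) * 2 ^ (r ^ 2 * k)) ^ (1 : ℝ) * (k.factorial : ℝ) ^ (2 : ℝ) := by gcongr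
    _ = 2 ^ (n + r * k) * 2 ^ (r ^ 2 * k) * (k.factorial : ℝ) ^ 2 := by
        rw [Real.rpow_one, Real.rpow_two]

theorem rpow_one_add_mul_div_sq {x y : ℝ} (hx : 0 < x) (hy : 0 < y) (β : ℝ) :
    x ^ (1 + β) * (y / x) ^ 2 = y ^ (1 + β) * (y / x) ^ (1 - β) := by
  have hsq : (y / x) ^ 2 = (y / x) ^ (1 + β) * (y / x) ^ (1 - β) := by
    rw [← Real.rpow_add (by positivity), ← Real.rpow_two]
    norm_num
  rw [hsq, ← mul_assoc, ← Real.mul_rpow hx.le (by positivity), mul_div_cancel₀ _ hx.ne']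

theorem exists_pow_mul_pow_le {a b c : ℝ} (ha : 0 ≤ a) (hb : 0 ≤ b) (hc : 1 < c) :
    ∃ s : ℕ, ∀ m k : ℕ, k ≤ m → a ^ m * b ^ k ≤ c ^ (s * m) := by
  obtain ⟨s, hs⟩ := pow_unbounded_of_one_lt (a * max 1 b) hc
  refine ⟨s, fun m k hkm => ?_⟩
  calc a ^ m * b ^ k ≤ a ^ m * max 1 b ^ k := by
        gcongr
        exact le_max_right 1 b
    _ ≤ a ^ m * max 1 b ^ m := by
        gcongr
        exact le_max_left 1 b
    _ = (a * max 1 b) ^ m := (mul_pow _ _ _).symm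
    _ ≤ (c ^ s) ^ m := by gcongr
    _ = c ^ (s * m) := (pow_mul _ _ _).symm

/-- The condition `max(0, r - 2) / r ≤ β < 1`, `1 ≤ r`, under which the exponential of an integral
kernel operator of order `r` exists on `(E)_β`; the lower bound on `β` is written without the
maximum and the quotient. -/
structure IsAdmissible (r : ℕ) (β : ℝ) : Prop where
  one_le : 1 ≤ r
  nonneg : 0 ≤ β
  lt_one : β < 1
  mul_one_sub_le : r * (1 - β) ≤ 2

theorem isAdmissible_of_max_div_le {r : ℕ} {β : ℝ} (hr : 1 ≤ r)
    (hβ : max 0 ((r : ℝ) - 2) / r ≤ β) (hβ' : β < 1) : IsAdmissible r β := by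
  have hr0 : (0 : ℝ) < r := by exact_mod_cast hr
  refine ⟨hr, le_trans (by positivity) hβ, hβ', ?_⟩
  linarith [(div_le_iff₀ hr0).1 hβ, le_max_right 0 ((r : ℝ) - 2)]

theorem isAdmissible_two {β : ℝ} (hβ : 0 ≤ β) (hβ' : β < 1) : IsAdmissible 2 β :=
  ⟨one_le_two, hβ, hβ', by push_cast; linarith⟩

theorem IsAdmissible.exists_factorial_bound {r : ℕ} {β : ℝ} (h : IsAdmissible r β) {C c : ℝ}
    (hC : 0 ≤ C) (hc : 1 < c) : ∃ s : ℕ, ∀ n k : ℕ,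
      (n.factorial : ℝ) ^ (1 + β) * (C ^ k * ((n + r * k).factorial / n.factorial)) ^ 2 ≤
        (k.factorial * (1 / 2) ^ k) ^ 2 *
          (((n + r * k).factorial : ℝ) ^ (1 + β) * (c ^ (s * (n + r * k))) ^ 2) := by
  obtain ⟨s, hs⟩ := exists_pow_mul_pow_le two_pos.le
    (by positivity : 0 ≤ C ^ 2 * 2 ^ (r ^ 2) * 4) (one_lt_pow₀ hc two_ne_zero)
  refine ⟨s, fun n k => ?_⟩
  have hn : (0 : ℝ) < n.factorial := by exact_mod_cast n.factorial_pos
  have hratio := factorial_ratio_rpow_le (sub_nonneg.2 h.lt_one.le)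
    (sub_le_self 1 h.nonneg) h.mul_one_sub_le n k
  have habsorb := hs (n + r * k) k ((Nat.le_mul_of_pos_left k h.one_le).trans le_add_self)
  set m := n + r * k
  have hm : (0 : ℝ) < m.factorial := by exact_mod_cast m.factorial_pos
  have hfour : ((1 / 2 : ℝ) ^ k) ^ 2 * 4 ^ k = 1 := by
    rw [pow_right_comm, ← mul_pow]
    norm_num
  calc (n.factorial : ℝ) ^ (1 + β) * (C ^ k * (m.factorial / n.factorial)) ^ 2
      = C ^ (2 * k) * ((n.factorial : ℝ) ^ (1 + β) * ((m.factorial : ℝ) / n.factorial) ^ 2) := by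
        ring
    _ = (m.factorial : ℝ) ^ (1 + β) *
          (C ^ (2 * k) * ((m.factorial : ℝ) / n.factorial) ^ (1 - β)) := by
        rw [rpow_one_add_mul_div_sq hn hm, mul_left_comm]
    _ ≤ (m.factorial : ℝ) ^ (1 + β) *
          (C ^ (2 * k) * (2 ^ m * 2 ^ (r ^ 2 * k) * (k.factorial : ℝ) ^ 2)) := by gcongr
    _ = (m.factorial : ℝ) ^ (1 + β) * (k.factorial * (1 / 2) ^ k) ^ 2 *
          (2 ^ m * (C ^ 2 * 2 ^ (r ^ 2) * 4) ^ k) := by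
        linear_combination -((m.factorial : ℝ) ^ (1 + β) *
          (C ^ (2 * k) * (2 ^ m * 2 ^ (r ^ 2 * k) * (k.factorial : ℝ) ^ 2))) * hfour
    _ ≤ (m.factorial : ℝ) ^ (1 + β) * (k.factorial * (1 / 2) ^ k) ^ 2 * (c ^ 2) ^ (s * m) := by
        gcongr
    _ = (k.factorial * (1 / 2) ^ k) ^ 2 *
          ((m.factorial : ℝ) ^ (1 + β) * (c ^ (s * m)) ^ 2) := by
        rw [pow_right_comm]
        ring

namespace Eigenbasis

variable {A : RealL2 →ₗ.[ℝ] RealL2} {S : Eigenbasis A} {β : ℝ} {n r : ℕ}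

theorem isSymm_contract {a b : ℕ} (h : a + b = n) (κ : S.Dual b) {f : S.Tensor n}
    (hf : IsSymm f) : IsSymm (contract h κ f) := by
  subst h
  refine isSymm_iff.2 fun σ J => congrArg κ (Koethe.ext fun K => ?_)
  have happend : Fin.append (J ∘ σ) K =
      Fin.append J K ∘ finSumFinEquiv.permCongr (Equiv.sumCongr σ (Equiv.refl (Fin b))) := by
    funext i
    refine Fin.addCases (fun i => ?_) (fun i => ?_) i <;> simp [Equiv.permCongr_apply]
  change f (Fin.append (J ∘ σ) K) = f (Fin.append J K)
  rw [happend, isSymm_iff.1 hf]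

theorem hasSum_weight_mul_tensorNorms_slice_sq {a b : ℕ} (h : a + b = n) (f : S.Tensor n)
    (p : ℕ) : HasSum (fun J => (S.weight a p J * S.tensorNorms b p (slice h f J)) ^ 2)
      (S.tensorNorms n p f ^ 2) := by
  have hjoin := (join h).summable_iff.2 (f.summable p)
  rw [Koethe.norms_sq, ← (join h).tsum_eq]
  convert hjoin.hasSum.prod_fiberwise fun J => (hjoin.prod_factor J).hasSum using 2 with J
  · rw [mul_pow, Koethe.norms_sq, ← tsum_mul_left]
    refine tsum_congr fun K => ?_
    rw [Function.comp_apply, weight_join, ← mul_pow, ← mul_assoc]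
    rfl
  · rfl

theorem exists_tensorNorms_contract_le {b : ℕ} (κ : S.Dual b) : ∃ (q : ℕ) (C : ℝ), 0 ≤ C ∧
    ∀ p, q ≤ p → ∀ {a n : ℕ} (h : a + b = n) (f : S.Tensor n),
      S.tensorNorms a p (contract h κ f) ≤ C * S.tensorNorms n p f := by
  obtain ⟨q, C, hC, hκ⟩ := exists_bound (Koethe.withSeminorms ℂ _) (Tensor.norms_mono b) κ
  refine ⟨q, C, hC, fun p hp a n h f => ?_⟩
  have hslice (J : Fin a → S.ι) : (S.weight a p J * ‖contract h κ f J‖) ^ 2 ≤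
      C ^ 2 * (S.weight a p J * S.tensorNorms b p (slice h f J)) ^ 2 := by
    have hκJ : ‖contract h κ f J‖ ≤ C * S.tensorNorms b p (slice h f J) :=
      (hκ _).trans (mul_le_mul_of_nonneg_left (Tensor.norms_mono b hp _) hC)
    have hw := (S.weight_pos a p J).le
    rw [← mul_pow, mul_left_comm]
    gcongr
  refine (pow_le_pow_iff_left₀ (apply_nonneg _ _) (mul_nonneg hC (apply_nonneg _ _))
    two_ne_zero).1 ?_
  rw [mul_pow, Koethe.norms_sq]
  exact hasSum_le hslice ((contract h κ f).summable p).hasSum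
    ((hasSum_weight_mul_tensorNorms_slice_sq h f p).mul_left _)

theorem exists_factorial_mul_tensorNorms_sq_le (h : IsAdmissible r β) {C : ℝ} (hC : 0 ≤ C) :
    ∃ s : ℕ, ∀ (n k p : ℕ) (g : S.Tensor n) (f : S.Tensor (n + r * k)),
      S.tensorNorms n p g ≤
        C ^ k * ((n + r * k).factorial / n.factorial) * S.tensorNorms (n + r * k) p f →
      (n.factorial : ℝ) ^ (1 + β) * S.tensorNorms n p g ^ 2 ≤
        (k.factorial * (1 / 2) ^ k) ^ 2 * (((n + r * k).factorial : ℝ) ^ (1 + β) *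
          S.tensorNorms (n + r * k) (p + s) f ^ 2) := by
  obtain ⟨c, hc, hgap⟩ := S.exists_pow_mul_tensorNorms_le
  obtain ⟨s, hs⟩ := h.exists_factorial_bound hC hc
  refine ⟨s, fun n k p g f hgf => ?_⟩
  have : 0 < c := one_pos.trans hc
  have := hgap _ p s f
  have : 0 ≤ S.tensorNorms n p g := apply_nonneg _ _
  have : 0 ≤ S.tensorNorms (n + r * k) p f := apply_nonneg _ _
  calc (n.factorial : ℝ) ^ (1 + β) * S.tensorNorms n p g ^ 2
      ≤ (n.factorial : ℝ) ^ (1 + β) * (C ^ k * ((n + r * k).factorial / n.factorial) *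
          S.tensorNorms (n + r * k) p f) ^ 2 := by gcongr
    _ = (n.factorial : ℝ) ^ (1 + β) * (C ^ k * ((n + r * k).factorial / n.factorial)) ^ 2 *
          S.tensorNorms (n + r * k) p f ^ 2 := by ring
    _ ≤ (k.factorial * (1 / 2) ^ k) ^ 2 * (((n + r * k).factorial : ℝ) ^ (1 + β) *
          (c ^ (s * (n + r * k))) ^ 2) * S.tensorNorms (n + r * k) p f ^ 2 :=
        mul_le_mul_of_nonneg_right (hs n k) (sq_nonneg _)
    _ = (k.factorial * (1 / 2) ^ k) ^ 2 * (((n + r * k).factorial : ℝ) ^ (1 + β) *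
          (c ^ (s * (n + r * k)) * S.tensorNorms (n + r * k) p f) ^ 2) := by ring
    _ ≤ _ := by gcongr

/-- The chaos coefficients `(n + r)! / n! κ ⊗_r f_{n + r}` of `Ξ_{0,r}(κ) φ`, for `φ ∼ (fₙ)`. -/
def kernelChaos (κ : S.Dual r) (φ : S.testFunctions β) (n : ℕ) : S.Tensor n :=
  ((n + r).factorial / n.factorial : ℂ) • contract rfl κ (chaos φ (n + r))

theorem isSymm_kernelChaos (κ : S.Dual r) (φ : S.testFunctions β) (n : ℕ) :
    IsSymm (kernelChaos κ φ n) := fun σ =>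
  (map_smul (permute σ) _ _).trans
    (congrArg _ (isSymm_contract rfl κ (isSymm_chaos φ (n + r)) σ))

theorem tensorNorms_kernelChaos (κ : S.Dual r) (φ : S.testFunctions β) (n p : ℕ) :
    S.tensorNorms n p (kernelChaos κ φ n) = (n + r).factorial / n.factorial *
      S.tensorNorms n p (contract rfl κ (chaos φ (n + r))) := by
  rw [kernelChaos, map_smul_eq_mul, norm_div, Complex.norm_natCast, Complex.norm_natCast]

theorem exists_kernelChaos_le (h : IsAdmissible r β) (κ : S.Dual r) (p : ℕ) :
    ∃ q, ∀ (φ : S.testFunctions β) n,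
      (n.factorial : ℝ) ^ (1 + β) * S.tensorNorms n p (kernelChaos κ φ n) ^ 2 ≤
        (1 / 2) ^ 2 * (((n + r).factorial : ℝ) ^ (1 + β) *
          S.tensorNorms (n + r) q (chaos φ (n + r)) ^ 2) := by
  obtain ⟨q, C, hC, hκ⟩ := exists_tensorNorms_contract_le κ
  obtain ⟨s, hs⟩ := exists_factorial_mul_tensorNorms_sq_le (S := S) h hC
  refine ⟨max p q + s, fun φ n => ?_⟩
  have hlevel : (n.factorial : ℝ) ^ (1 + β) *
      S.tensorNorms n (max p q) (kernelChaos κ φ n) ^ 2 ≤ _ :=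
    hs n 1 (max p q) _ (chaos φ (n + r * 1)) <| by
      rw [mul_one, pow_one, tensorNorms_kernelChaos, mul_comm C, mul_assoc]
      exact mul_le_mul_of_nonneg_left (hκ _ (le_max_right p q) rfl _) (by positivity)
  have := Tensor.norms_mono n (le_max_left p q) (kernelChaos κ φ n)
  have : 0 ≤ S.tensorNorms n p (kernelChaos κ φ n) := apply_nonneg _ _
  refine le_trans ?_ (hlevel.trans_eq ?_)
  · gcongr
  · rw [mul_one, Nat.factorial_one, Nat.cast_one, one_mul, pow_one]

theorem summable_kernelChaos (h : IsAdmissible r β) (κ : S.Dual r) (φ : S.testFunctions β)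
    (p : ℕ) : Summable fun n =>
      (n.factorial : ℝ) ^ (1 + β) * S.tensorNorms n p (kernelChaos κ φ n) ^ 2 := by
  obtain ⟨q, hq⟩ := exists_kernelChaos_le h κ p
  exact .of_nonneg_of_le (fun n => by positivity) (hq φ)
    (((hasSum_fockNorms_sq q φ).summable.comp_injective (add_left_injective r)).mul_left _)

/-- The integral kernel operator `Ξ_{0,r}(κ)` on `(E)_β`. -/
def integralKernelOperator (h : IsAdmissible r β) (κ : S.Dual r) :
    S.testFunctions β →L[ℂ] S.testFunctions β :=
  let T : S.testFunctions β →ₗ[ℂ] S.testFunctions β :=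
    { toFun := fun φ =>
        ofChaos (kernelChaos κ φ) (isSymm_kernelChaos κ φ) (summable_kernelChaos h κ φ)
      map_add' := fun φ ψ => ext_chaos fun n => by
        simp only [chaos_ofChaos, chaos_add, kernelChaos, map_add, smul_add]
      map_smul' := fun c φ => ext_chaos fun n => by
        simp only [chaos_ofChaos, chaos_smul, kernelChaos, map_smul, RingHom.id_apply]
        rw [smul_comm] }
  ⟨T, WithSeminorms.continuous_of_isBounded fockWithSeminorms fockWithSeminorms T <|
    Seminorm.IsBounded.of_real fun p => by
      obtain ⟨q, hq⟩ := exists_kernelChaos_le h κ p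
      refine ⟨{q}, 1 / 2, fun φ => ?_⟩
      rw [Finset.sup_singleton]
      exact fockNorms_le_of_chaos_le (ψ := T φ) (by norm_num) (hq φ)⟩

@[simp] theorem chaos_integralKernelOperator (h : IsAdmissible r β) (κ : S.Dual r)
    (φ : S.testFunctions β) (n : ℕ) :
    chaos (integralKernelOperator h κ φ) n = kernelChaos κ φ n := rfl

theorem isIntegralKernelOperator (h : IsAdmissible r β) (κ : S.Dual r) :
    IsIntegralKernelOperator κ (integralKernelOperator h κ) := fun _ _ => rfl

theorem integralKernelOperator_smul (h : IsAdmissible r β) (t : ℂ) (κ : S.Dual r) :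
    integralKernelOperator h (t • κ) = t • integralKernelOperator h κ :=
  ContinuousLinearMap.ext fun φ => ext_chaos fun n => by
    rw [smul_apply, chaos_smul, chaos_integralKernelOperator, chaos_integralKernelOperator,
      kernelChaos, kernelChaos, smul_comm]
    rfl

theorem tensorNorms_chaos_pow_le (h : IsAdmissible r β) {κ : S.Dual r} {p : ℕ} {C : ℝ}
    (hC : 0 ≤ C) (hκ : ∀ {a n : ℕ} (h : a + r = n) (f : S.Tensor n),
      S.tensorNorms a p (contract h κ f) ≤ C * S.tensorNorms n p f)
    (φ : S.testFunctions β) {n k m : ℕ} (hm : n + r * k = m) :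
    S.tensorNorms n p (chaos ((integralKernelOperator h κ ^ k) φ) n) ≤
      C ^ k * (m.factorial / n.factorial) * S.tensorNorms m p (chaos φ m) := by
  induction k generalizing n with
  | zero =>
    obtain rfl : n = m := by simpa using hm
    have hn : (n.factorial : ℝ) ≠ 0 := by exact_mod_cast n.factorial_ne_zero
    simp [div_self hn]
  | succ k ih =>
    rw [pow_succ', mul_apply_eq_comp, chaos_integralKernelOperator, tensorNorms_kernelChaos]
    have : (0 : ℝ) < (n + r).factorial := by exact_mod_cast (n + r).factorial_pos
    calc ((n + r).factorial / n.factorial : ℝ) * S.tensorNorms n p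
          (contract rfl κ (chaos ((integralKernelOperator h κ ^ k) φ) (n + r)))
        ≤ ((n + r).factorial / n.factorial : ℝ) * (C * (C ^ k *
            (m.factorial / (n + r).factorial) * S.tensorNorms m p (chaos φ m))) := by
          refine mul_le_mul_of_nonneg_left ((hκ rfl _).trans ?_) (by positivity)
          exact mul_le_mul_of_nonneg_left (ih (by rw [← hm]; ring)) hC
      _ = C ^ (k + 1) * (m.factorial / n.factorial) * S.tensorNorms m p (chaos φ m) := by
          field_simp
          ring

theorem exists_fockNorms_pow_le (h : IsAdmissible r β) (κ : S.Dual r) (p : ℕ) :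
    ∃ q, ∀ k (φ : S.testFunctions β),
      S.fockNorms β p ((integralKernelOperator h κ ^ k) φ) ≤
        k.factorial * (1 / 2) ^ k * S.fockNorms β q φ := by
  obtain ⟨q, C, hC, hκ⟩ := exists_tensorNorms_contract_le κ
  obtain ⟨s, hs⟩ := exists_factorial_mul_tensorNorms_sq_le (S := S) h hC
  refine ⟨max p q + s, fun k φ => (fockNorms_mono (le_max_left p q) _).trans ?_⟩
  exact fockNorms_le_of_chaos_le (d := r * k) (by positivity) fun n =>
    hs n k (max p q) _ _ (tensorNorms_chaos_pow_le h hC (hκ _ (le_max_right p q)) φ rfl)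

theorem exists_isExp_integralKernelOperator (h : IsAdmissible r β) (κ : S.Dual r) :
    ∃ U, IsExp (integralKernelOperator h κ) U := by
  have hT (p : ℕ) : ∃ q, ∀ k (φ : S.testFunctions β),
      S.fockNorms β p (((k.factorial : ℂ)⁻¹ • integralKernelOperator h κ ^ k) φ) ≤
        (1 / 2) ^ k * S.fockNorms β q φ := by
    obtain ⟨q, hq⟩ := exists_fockNorms_pow_le h κ p
    refine ⟨q, fun k φ => ?_⟩
    rw [smul_apply, map_smul_eq_mul, norm_inv, Complex.norm_natCast,
      inv_mul_le_iff₀ (by exact_mod_cast k.factorial_pos), ← mul_assoc]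
    exact hq k φ
  obtain ⟨U, hU⟩ := exists_clm_hasSum_apply fockWithSeminorms
    (fun _ => summable_of_summable_fockNorms) summable_geometric_two hT
  exact ⟨U, hasSum_clm_of_hasSum_apply fockWithSeminorms summable_geometric_two hT hU⟩

/-- The operator `exp(Ξ_{0,r}(κ))` on `(E)_β`. -/
def expKernel (h : IsAdmissible r β) (κ : S.Dual r) :
    S.testFunctions β →L[ℂ] S.testFunctions β :=
  (exists_isExp_integralKernelOperator h κ).choose

theorem isExp_expKernel (h : IsAdmissible r β) (κ : S.Dual r) :
    IsExp (integralKernelOperator h κ) (expKernel h κ) :=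
  (exists_isExp_integralKernelOperator h κ).choose_spec

theorem isExp_smul_expKernel_smul (h : IsAdmissible r β) (t : ℂ) (κ : S.Dual r) :
    IsExp (t • integralKernelOperator h κ) (expKernel h (t • κ)) :=
  integralKernelOperator_smul h t κ ▸ isExp_expKernel h (t • κ)

end Eigenbasis

/-! ### Wick tensors and the renormalization operator -/

theorem choose_two_mul_mul_doubleFactorial {m k : ℕ} (h : 2 * k ≤ m) :
    (m.choose (2 * k) : ℂ) * (Nat.doubleFactorial (2 * k - 1) : ℂ) * (-1) ^ k =
      (m.factorial : ℂ) / ((m - 2 * k).factorial * k.factorial) * (-(1 / 2)) ^ k := by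
  have hdouble : (2 * k).factorial = 2 ^ k * k.factorial * Nat.doubleFactorial (2 * k - 1) := by
    rcases k with _ | k
    · simp
    · rw [← Nat.doubleFactorial_two_mul]
      exact Nat.factorial_eq_mul_doubleFactorial (2 * k + 1)
  have hchoose : (m.choose (2 * k) : ℂ) *
      (2 ^ k * k.factorial * Nat.doubleFactorial (2 * k - 1)) * (m - 2 * k).factorial =
        m.factorial := by
    exact_mod_cast hdouble ▸ Nat.choose_mul_factorial_mul_factorial h
  have hrest : ((m - 2 * k).factorial : ℂ) ≠ 0 := by exact_mod_cast (m - 2 * k).factorial_ne_zero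
  have hk : (k.factorial : ℂ) ≠ 0 := by exact_mod_cast k.factorial_ne_zero
  rw [← hchoose, neg_pow (1 / 2 : ℂ), div_pow, one_pow]
  field_simp

namespace Eigenbasis

variable {A : RealL2 →ₗ.[ℝ] RealL2} {S : Eigenbasis A} {β : ℝ} {r : ℕ}

theorem IsExp.hasSum_apply {T U : S.testFunctions β →L[ℂ] S.testFunctions β} (h : IsExp T U)
    (φ : S.testFunctions β) : HasSum (fun k : ℕ => (k.factorial : ℂ)⁻¹ • (T ^ k) φ) (U φ) :=
  HasSum.map h (⟨⟨fun T => T φ, rfl⟩, fun _ _ => rfl⟩ :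
    (S.testFunctions β →L[ℂ] S.testFunctions β) →+ S.testFunctions β)
    (ContinuousEvalConst.continuous_eval_const φ)

section ExponentialVectors

variable (h : IsAdmissible r β) (κ : S.Dual r)

theorem integralKernelOperator_expVec (z : S.ComplexTestSpace) :
    integralKernelOperator h κ (expVec h.lt_one z) = κ (vecPow z r) • expVec h.lt_one z :=
  ext_chaos fun n => by
    have hfactorial : ((n + r).factorial : ℂ) ≠ 0 := by exact_mod_cast (n + r).factorial_ne_zero
    rw [chaos_integralKernelOperator, kernelChaos, chaos_smul, chaos_expVec, chaos_expVec,
      map_smul, contract_vecPow, smul_smul, smul_smul, smul_smul]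
    congr 1
    field_simp

theorem integralKernelOperator_pow_expVec (z : S.ComplexTestSpace) (k : ℕ) :
    (integralKernelOperator h κ ^ k) (expVec h.lt_one z) =
      κ (vecPow z r) ^ k • expVec h.lt_one z := by
  induction k with
  | zero => simp
  | succ k ih =>
    rw [pow_succ', mul_apply_eq_comp, ih, map_smul, integralKernelOperator_expVec, smul_smul,
      pow_succ]

theorem expKernel_expVec (z : S.ComplexTestSpace) : expKernel h κ (expVec h.lt_one z) =
    Complex.exp (κ (vecPow z r)) • expVec h.lt_one z := by
  refine ((isExp_expKernel h κ).hasSum_apply _).unique ?_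
  rw [Complex.exp_eq_exp_ℂ]
  refine ((NormedSpace.expSeries_div_hasSum_exp (κ (vecPow z r))).smul_const
    (expVec h.lt_one z)).congr_fun fun k => ?_
  rw [integralKernelOperator_pow_expVec, smul_smul, inv_mul_eq_div]

theorem expKernel_comp_expKernel (κ' : S.Dual r) :
    (expKernel h κ).comp (expKernel h κ') = expKernel h (κ + κ') :=
  operator_ext_expVec h.lt_one fun t => by
    rw [ContinuousLinearMap.comp_apply, expKernel_expVec, map_smul, expKernel_expVec,
      expKernel_expVec, smul_smul, ← Complex.exp_add, add_apply, add_comm]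

theorem expKernel_zero : expKernel h (0 : S.Dual r) = ContinuousLinearMap.id ℂ _ :=
  operator_ext_expVec h.lt_one fun t => by
    rw [expKernel_expVec, zero_apply, Complex.exp_zero, one_smul, ContinuousLinearMap.id_apply]

theorem expKernel_neg_apply_expKernel (φ : S.testFunctions β) :
    expKernel h (-κ) (expKernel h κ φ) = φ := by
  rw [← ContinuousLinearMap.comp_apply, expKernel_comp_expKernel, neg_add_cancel, expKernel_zero,
    ContinuousLinearMap.id_apply]

theorem expKernel_comm {r' : ℕ} (h' : IsAdmissible r' β) (κ' : S.Dual r')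
    (φ : S.testFunctions β) :
    expKernel h κ (expKernel h' κ' φ) = expKernel h' κ' (expKernel h κ φ) := by
  have hcomp : (expKernel h κ).comp (expKernel h' κ') = (expKernel h' κ').comp (expKernel h κ) :=
    operator_ext_expVec h.lt_one fun t => by
      rw [ContinuousLinearMap.comp_apply, ContinuousLinearMap.comp_apply, expKernel_expVec,
        expKernel_expVec, map_smul, map_smul, expKernel_expVec, expKernel_expVec, smul_comm]
  exact DFunLike.congr_fun hcomp φ

end ExponentialVectors

/-- The `m`-th term `z^{⊗ m} / m!` of the exponential vector `Φ_z`, as an element of `(E)_β`. -/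
def expTerm (β : ℝ) (z : S.ComplexTestSpace) (m : ℕ) : S.testFunctions β :=
  (m.factorial : ℂ)⁻¹ • S.homogeneous β m (vecPow z m)

theorem chaos_expTerm_self (z : S.ComplexTestSpace) (m : ℕ) :
    chaos (expTerm β z m) m = (m.factorial : ℂ)⁻¹ • vecPow z m := by
  rw [expTerm, chaos_smul, chaos_homogeneous_self, (isSymm_vecPow z m).symPart_eq]

theorem chaos_expTerm_of_ne (z : S.ComplexTestSpace) {m n : ℕ} (h : n ≠ m) :
    chaos (expTerm β z m) n = 0 := by
  rw [expTerm, chaos_smul, chaos_homogeneous_of_ne h, smul_zero]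

theorem pointEval_expTerm (hβ : 0 ≤ β) (x : S.DualSpace) (z : S.ComplexTestSpace) (m : ℕ) :
    pointEval hβ x (expTerm β z m) = (m.factorial : ℂ)⁻¹ * dualPair x z ^ m := by
  rw [expTerm, map_smul, pointEval_homogeneous hβ x (isSymm_vecPow z m), pointPow_vecPow,
    smul_eq_mul]

section ExpTerm

variable (h : IsAdmissible r β) (κ : S.Dual r) (z : S.ComplexTestSpace)

theorem integralKernelOperator_expTerm (m : ℕ) :
    integralKernelOperator h κ (expTerm β z (m + r)) = κ (vecPow z r) • expTerm β z m :=
  ext_chaos fun n => by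
    rw [chaos_integralKernelOperator, kernelChaos, chaos_smul]
    rcases eq_or_ne n m with rfl | hne
    · have hfactorial : ((n + r).factorial : ℂ) ≠ 0 := by
        exact_mod_cast (n + r).factorial_ne_zero
      rw [chaos_expTerm_self, chaos_expTerm_self, map_smul, contract_vecPow, smul_smul, smul_smul,
        smul_smul]
      congr 1
      field_simp
    · rw [chaos_expTerm_of_ne z hne, chaos_expTerm_of_ne z ((add_left_injective r).ne hne),
        map_zero, smul_zero, smul_zero]

theorem integralKernelOperator_expTerm_of_lt {m : ℕ} (hm : m < r) :
    integralKernelOperator h κ (expTerm β z m) = 0 := ext_chaos fun n => by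
  rw [chaos_integralKernelOperator, kernelChaos, chaos_expTerm_of_ne z (by omega), map_zero,
    smul_zero]
  rfl

theorem integralKernelOperator_pow_expTerm (m k : ℕ) :
    (integralKernelOperator h κ ^ k) (expTerm β z (m + r * k)) =
      κ (vecPow z r) ^ k • expTerm β z m := by
  induction k with
  | zero => simp
  | succ k ih =>
    rw [pow_succ, mul_apply_eq_comp, Nat.mul_succ, ← add_assoc, integralKernelOperator_expTerm,
      map_smul, ih, smul_smul, pow_succ']

theorem integralKernelOperator_pow_expTerm_of_lt {m k : ℕ} (hm : m < r * k) :
    (integralKernelOperator h κ ^ k) (expTerm β z m) = 0 := by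
  induction k generalizing m with
  | zero => omega
  | succ k ih =>
    rw [pow_succ, mul_apply_eq_comp]
    rcases lt_or_ge m r with hlt | hge
    · rw [integralKernelOperator_expTerm_of_lt h κ z hlt, map_zero]
    · obtain ⟨d, rfl⟩ := Nat.exists_eq_add_of_le' hge
      rw [integralKernelOperator_expTerm, map_smul, ih (by lia), smul_zero]

theorem expKernel_expTerm (m : ℕ) : expKernel h κ (expTerm β z m) =
    ∑ k : Fin (m / r + 1),
      ((k : ℕ).factorial : ℂ)⁻¹ • κ (vecPow z r) ^ (k : ℕ) • expTerm β z (m - r * k) := by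
  have hvanish (k : ℕ) (hk : k ∉ Finset.range (m / r + 1)) :
      (k.factorial : ℂ)⁻¹ • (integralKernelOperator h κ ^ k) (expTerm β z m) = 0 := by
    have hlt : m < r * k := by
      rwa [Finset.mem_range, Nat.lt_succ_iff, Nat.le_div_iff_mul_le h.one_le, not_le,
        mul_comm] at hk
    rw [integralKernelOperator_pow_expTerm_of_lt h κ z hlt, smul_zero]
  rw [((isExp_expKernel h κ).hasSum_apply _).unique (hasSum_sum_of_ne_finset_zero hvanish),
    ← Fin.sum_univ_eq_sum_range]
  refine Finset.sum_congr rfl fun k _ => ?_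
  rw [← integralKernelOperator_pow_expTerm h, Nat.sub_add_cancel (mul_le_of_fin k)]

end ExpTerm

theorem isSymmDual_genWick (κ : S.Dual r) (x : S.DualSpace) (m : ℕ) :
    IsSymmDual (genWick κ x m) := fun σ f => by
  simp only [genWick, sum_apply, smul_apply, symTensor, isSymmDual_symmetrize _ σ]

theorem isSymmDual_wick (x : S.DualSpace) (m : ℕ) : IsSymmDual (wick x m) := fun σ f => by
  simp only [wick, sum_apply, smul_apply, symTensor, isSymmDual_symmetrize _ σ]

theorem genWick_vecPow (κ : S.Dual r) (x : S.DualSpace) (m : ℕ) (z : S.ComplexTestSpace) :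
    genWick κ x m (vecPow z m) = ∑ k : Fin (m / r + 1),
      (m.factorial : ℂ) / ((m - r * k).factorial * (k : ℕ).factorial) * (-(1 / 2)) ^ (k : ℕ) *
        (dualPair x z ^ (m - r * k) * κ (vecPow z r) ^ (k : ℕ)) := by
  simp only [genWick, sum_apply, smul_apply, symTensor, symTensorPow, symmetrize_vecPow,
    tensor_vecPow, pointPow_vecPow, tensorPow_vecPow, smul_eq_mul]

theorem wick_vecPow (x : S.DualSpace) (m : ℕ) (z : S.ComplexTestSpace) :
    wick x m (vecPow z m) = ∑ k : Fin (m / 2 + 1),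
      (m.choose (2 * k) : ℂ) * (Nat.doubleFactorial (2 * k - 1) : ℂ) * (-1) ^ (k : ℕ) *
        (dualPair x z ^ (m - 2 * k) * trace (vecPow z 2) ^ (k : ℕ)) := by
  simp only [wick, sum_apply, smul_apply, symTensor, symmetrize_vecPow, tensor_vecPow,
    pointPow_vecPow, tensorPow_vecPow, smul_eq_mul]

theorem genWick_trace (x : S.DualSpace) (m : ℕ) : genWick trace x m = wick x m :=
  (isSymmDual_genWick _ x m).ext (isSymmDual_wick x m) fun t => by
    rw [genWick_vecPow, wick_vecPow]
    exact Finset.sum_congr rfl fun k _ => by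
      rw [choose_two_mul_mul_doubleFactorial (mul_le_of_fin k)]

theorem pointEval_expKernel_homogeneous (h : IsAdmissible r β) (κ : S.Dual r) (x : S.DualSpace)
    (m : ℕ) (f : S.Tensor m) :
    pointEval h.nonneg x (expKernel h (-(1 / 2 : ℂ) • κ) (S.homogeneous β m f)) =
      genWick κ x m f := by
  let L : S.Dual m :=
    ((pointEval h.nonneg x).comp (expKernel h (-(1 / 2 : ℂ) • κ))).comp (S.homogeneous β m)
  have hL : IsSymmDual L := fun σ g =>
    congrArg (fun φ => pointEval h.nonneg x (expKernel h _ φ)) (homogeneous_permute σ g)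
  suffices hLW : L = genWick κ x m from DFunLike.congr_fun hLW f
  refine hL.ext (isSymmDual_genWick κ x m) fun t => ?_
  have hm : (m.factorial : ℂ) ≠ 0 := by exact_mod_cast m.factorial_ne_zero
  have hterm : S.homogeneous β m (vecPow (S.finVec t) m) =
      (m.factorial : ℂ) • expTerm β (S.finVec t) m := (smul_inv_smul₀ hm _).symm
  change pointEval h.nonneg x (expKernel h _ (S.homogeneous β m (vecPow (S.finVec t) m))) = _
  rw [hterm, map_smul, map_smul, expKernel_expTerm, map_sum, smul_eq_mul, Finset.mul_sum,
    genWick_vecPow]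
  refine Finset.sum_congr rfl fun k _ => ?_
  simp only [map_smul, pointEval_expTerm, smul_apply, smul_eq_mul, mul_pow]
  field_simp

variable (S) in
/-- The renormalization operator `exp(-½ Δ_G)` on `(E)_β`, where `Δ_G = Ξ_{0,2}(τ)`; its inverse
is `exp(½ Δ_G)`. -/
def renormalization (hβ : 0 ≤ β) (hβ' : β < 1) : S.testFunctions β ≃L[ℂ] S.testFunctions β :=
  ContinuousLinearEquiv.equivOfInverse
    (expKernel (isAdmissible_two hβ hβ') (-(1 / 2 : ℂ) • trace))
    (expKernel (isAdmissible_two hβ hβ') (-(-(1 / 2 : ℂ) • trace)))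
    (expKernel_neg_apply_expKernel _ _)
    fun φ => by
      simpa only [neg_neg] using
        expKernel_neg_apply_expKernel (isAdmissible_two hβ hβ') (-(-(1 / 2 : ℂ) • trace)) φ

theorem coe_renormalization (hβ : 0 ≤ β) (hβ' : β < 1) :
    (S.renormalization hβ hβ' : S.testFunctions β →L[ℂ] S.testFunctions β) =
      expKernel (isAdmissible_two hβ hβ') (-(1 / 2 : ℂ) • trace) := rfl

theorem hasSum_wick_chaos (hβ : 0 ≤ β) (hβ' : β < 1) (x : S.DualSpace) (φ : S.testFunctions β) :
    HasSum (fun n => wick x n (chaos φ n)) (pointEval hβ x (S.renormalization hβ hβ' φ)) :=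
  ((hasSum_homogeneous_chaos φ).mapL ((pointEval hβ x).comp
    (S.renormalization hβ hβ' : S.testFunctions β →L[ℂ] S.testFunctions β))).congr_fun fun n => by
      rw [coe_renormalization, ContinuousLinearMap.comp_apply,
        pointEval_expKernel_homogeneous (isAdmissible_two hβ hβ'), genWick_trace]

theorem isFunction_iff (hβ : 0 ≤ β) (hβ' : β < 1) {φ : S.testFunctions β} {F : S.DualSpace → ℂ} :
    IsFunction φ F ↔ ∀ x, pointEval hβ x (S.renormalization hβ hβ' φ) = F x :=
  ⟨fun hF x => (hasSum_wick_chaos hβ hβ' x φ).unique (hF x),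
    fun hF x => hF x ▸ hasSum_wick_chaos hβ hβ' x φ⟩

theorem isFunction_pointEval_iff (hβ : 0 ≤ β) (hβ' : β < 1) {φ ψ : S.testFunctions β} :
    IsFunction φ (fun x => pointEval hβ x ψ) ↔ S.renormalization hβ hβ' φ = ψ :=
  (isFunction_iff hβ hβ').trans ⟨ext_pointEval hβ, fun h _ => by rw [h]⟩

theorem isFunction_pointPow_iff (hβ : 0 ≤ β) (hβ' : β < 1) {m : ℕ} {f : S.Tensor m}
    (hf : IsSymm f) {φ : S.testFunctions β} : IsFunction φ (fun x => pointPow x m f) ↔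
      S.renormalization hβ hβ' φ = S.homogeneous β m f := by
  simp only [← isFunction_pointEval_iff, pointEval_homogeneous hβ _ hf]

theorem isFunction_exp_iff (hβ : 0 ≤ β) (hβ' : β < 1) {φ : S.testFunctions β}
    {ξ η : S.TestSpace} :
    IsFunction φ (fun x => Complex.exp ((x ξ : ℂ) + Complex.I * (x η : ℂ))) ↔
      S.renormalization hβ hβ' φ = expVec hβ' (complexVec ξ η) := by
  simp only [← isFunction_pointEval_iff, pointEval_expVec, dualPair_complexVec]

theorem existsUnique_isFunction_pointPow (hβ : 0 ≤ β) (hβ' : β < 1) {m : ℕ} {f : S.Tensor m}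
    (hf : IsSymm f) : ∃! φ : S.testFunctions β, IsFunction φ fun x => pointPow x m f := by
  simp only [isFunction_pointPow_iff hβ hβ' hf]
  exact (S.renormalization hβ hβ').bijective.existsUnique _

theorem isFunction_expKernel_of_pointPow (h : IsAdmissible r β) (κ : S.Dual r) {m : ℕ}
    {f : S.Tensor m} (hf : IsSymm f) {φ : S.testFunctions β}
    (hφ : IsFunction φ fun x => pointPow x m f) :
    IsFunction (expKernel h (-(1 / 2 : ℂ) • κ) φ) fun x => genWick κ x m f := by
  rw [isFunction_pointPow_iff h.nonneg h.lt_one hf] at hφ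
  refine (isFunction_iff h.nonneg h.lt_one).2 fun x => ?_
  rw [← pointEval_expKernel_homogeneous h, ← hφ]
  exact congrArg (pointEval h.nonneg x) (expKernel_comm _ _ h _ φ)

theorem isRenormalization_iff {Θ : S.testFunctions 0 →L[ℂ] S.testFunctions 0} :
    IsRenormalization Θ ↔ Θ = S.renormalization le_rfl one_pos := by
  constructor
  · intro hΘ
    let R : S.testFunctions 0 ≃L[ℂ] S.testFunctions 0 := S.renormalization le_rfl one_pos
    have hcomp : Θ.comp (R.symm : S.testFunctions 0 →L[ℂ] S.testFunctions 0) =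
        ContinuousLinearMap.id ℂ _ := operator_ext_expVec one_pos fun t => by
      obtain ⟨ξ, hξ⟩ := exists_complexVec_eq_finVec t
      obtain ⟨φ, hφ, hΘφ⟩ := hΘ ξ 0
      rw [isFunction_exp_iff le_rfl one_pos, ← R.eq_symm_apply] at hφ
      rwa [isExpVector_iff one_pos, hφ, hξ] at hΘφ
    ext1 φ
    simpa using DFunLike.congr_fun hcomp (R φ)
  · rintro rfl ξ η
    let ψ : S.testFunctions 0 := expVec one_pos (complexVec ξ η)
    have hψ := (S.renormalization le_rfl one_pos).apply_symm_apply ψ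
    exact ⟨_, (isFunction_exp_iff le_rfl one_pos).2 hψ, (isExpVector_iff one_pos).2 hψ⟩

end Eigenbasis

/-! ### The eigenbasis of a white noise operator -/

section HilbertSchmidt

variable {𝕜 H K ι ι' : Type*} [RCLike 𝕜]
variable [NormedAddCommGroup H] [InnerProductSpace 𝕜 H]
variable [NormedAddCommGroup K] [InnerProductSpace 𝕜 K]

theorem hasSum_norm_inner_sq (b : HilbertBasis ι 𝕜 H) (x : H) :
    HasSum (fun i => ‖inner 𝕜 (b i) x‖ ^ 2) (‖x‖ ^ 2) := by
  simpa [b.repr_apply_apply] using lp.hasSum_norm (p := 2) (by norm_num) (b.repr x)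

theorem hasSum_norm_inner_apply_sq [CompleteSpace H] [CompleteSpace K] (b : HilbertBasis ι 𝕜 H)
    (R : H →L[𝕜] K) (y : K) : HasSum (fun i => ‖inner 𝕜 y (R (b i))‖ ^ 2) (‖R.adjoint y‖ ^ 2) := by
  simpa only [R.adjoint_inner_right, norm_inner_symm] using hasSum_norm_inner_sq b (R.adjoint y)

theorem norm_le_sqrt_tsum_norm_apply_sq [CompleteSpace H] [CompleteSpace K]
    (b : HilbertBasis ι 𝕜 H) {R : H →L[𝕜] K} (hR : Summable fun i => ‖R (b i)‖ ^ 2) :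
    ‖R‖ ≤ √(∑' i, ‖R (b i)‖ ^ 2) := by
  rw [← LinearIsometryEquiv.norm_map ContinuousLinearMap.adjoint R]
  refine ContinuousLinearMap.opNorm_le_bound _ (Real.sqrt_nonneg _) fun y => ?_
  refine le_of_sq_le_sq ?_ (by positivity)
  rw [mul_pow, Real.sq_sqrt (tsum_nonneg fun i => sq_nonneg _)]
  refine hasSum_le (fun i => ?_) (hasSum_norm_inner_apply_sq b R y) (hR.hasSum.mul_right (‖y‖ ^ 2))
  rw [← mul_pow, mul_comm]
  gcongr
  exact norm_inner_le_norm y (R (b i))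

theorem isCompactOperator_of_summable_norm_apply_sq [CompleteSpace H] [CompleteSpace K]
    (b : HilbertBasis ι 𝕜 H) {R : H →L[𝕜] K} (hR : Summable fun i => ‖R (b i)‖ ^ 2) :
    IsCompactOperator R := by
  classical
  let F (s : Finset ι) : H →L[𝕜] K := ∑ i ∈ s, (innerSL 𝕜 (b i)).smulRight (R (b i))
  have isCompactOperator_F (s : Finset ι) : IsCompactOperator (F s) :=
    Submodule.sum_mem (compactOperator (RingHom.id 𝕜) H K) fun i _ =>
      (isCompactOperator_of_locallyCompactSpace_dom (innerSL 𝕜 (b i))).clm_comp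
        (ContinuousLinearMap.toSpanSingleton 𝕜 (R (b i)))
  have sub_F_apply (s : Finset ι) (j : ι) :
      ‖(R - F s) (b j)‖ ^ 2 = ({i | i ∉ s} : Set ι).indicator (fun i => ‖R (b i)‖ ^ 2) j := by
    by_cases hj : j ∈ s <;>
      simp [F, sum_apply, orthonormal_iff_ite.1 b.orthonormal, hj]
  have norm_sub_F_le (s : Finset ι) : ‖F s - R‖ ≤ √(∑' i : {i // i ∉ s}, ‖R (b i)‖ ^ 2) := by
    have hsum : Summable fun j => ‖(R - F s) (b j)‖ ^ 2 := by
      simpa only [sub_F_apply] using hR.indicator _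
    rw [norm_sub_rev]
    refine (norm_le_sqrt_tsum_norm_apply_sq b hsum).trans_eq ?_
    rw [tsum_congr (sub_F_apply s)]
    exact congrArg _ (tsum_subtype {i | i ∉ s} fun i => ‖R (b i)‖ ^ 2).symm
  refine isCompactOperator_of_tendsto (l := Filter.atTop) (F := F) ?_
    (Filter.Eventually.of_forall isCompactOperator_F)
  rw [tendsto_iff_norm_sub_tendsto_zero]
  refine squeeze_zero (fun s => norm_nonneg _) norm_sub_F_le ?_
  simpa using (tendsto_tsum_compl_atTop_zero fun i => ‖R (b i)‖ ^ 2).sqrt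

theorem summable_norm_adjoint_apply_sq [CompleteSpace H] [CompleteSpace K]
    (b : HilbertBasis ι 𝕜 H) (e : HilbertBasis ι' 𝕜 K) {R : H →L[𝕜] K}
    (hR : Summable fun i => ‖R (b i)‖ ^ 2) : Summable fun j => ‖R.adjoint (e j)‖ ^ 2 := by
  have hentries : Summable fun x : ι × ι' => ‖inner 𝕜 (e x.2) (R (b x.1))‖ ^ 2 := by
    refine (summable_prod_of_nonneg fun x => sq_nonneg _).2 ⟨fun i => ?_, ?_⟩
    · exact (hasSum_norm_inner_sq e (R (b i))).summable
    · exact hR.congr fun i => (hasSum_norm_inner_sq e (R (b i))).tsum_eq.symm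
  refine hentries.prod_symm.prod.congr fun j => ?_
  exact (hasSum_norm_inner_apply_sq b R (e j)).tsum_eq

theorem exists_hilbertBasis_of_orthogonalFamily [CompleteSpace H] {V : ι → Submodule 𝕜 H}
    [∀ i, CompleteSpace (V i)] (hV : OrthogonalFamily 𝕜 (fun i => V i) fun i => (V i).subtypeₗᵢ)
    (hbot : (⨆ i, V i)ᗮ = ⊥) :
    ∃ (w : ∀ i, Set (V i)) (e : HilbertBasis (Σ i, w i) 𝕜 H), ∀ i (a : w i), e ⟨i, a⟩ ∈ V i := by
  choose w b _ using fun i => exists_hilbertBasis 𝕜 (V i)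
  let v : (Σ i, w i) → H := fun a => b a.1 a.2
  have hv : Orthonormal 𝕜 v := hV.orthonormal_sigma_orthonormal fun i => (b i).orthonormal
  have hv_bot : (Submodule.span 𝕜 (Set.range v))ᗮ = ⊥ := by
    rw [eq_bot_iff, ← hbot, ← Submodule.iInf_orthogonal]
    refine fun x hx => (Submodule.mem_iInf _).2 fun i => (Submodule.mem_orthogonal' _ _).2 ?_
    have inner_comp_eq_zero : (innerSL 𝕜 x).comp (V i).subtypeL = 0 := by
      refine ContinuousLinearMap.ext_on (s := Set.range (b i)) ?_ ?_
      · exact Submodule.dense_iff_topologicalClosure_eq_top.2 (b i).dense_span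
      · rintro _ ⟨a, rfl⟩
        exact (Submodule.mem_orthogonal' _ _).1 hx _ (Submodule.subset_span ⟨⟨i, a⟩, rfl⟩)
    exact fun y hy => DFunLike.congr_fun inner_comp_eq_zero ⟨y, hy⟩
  refine ⟨w, HilbertBasis.mkOfOrthogonalEqBot hv hv_bot, fun i a => ?_⟩
  rw [HilbertBasis.coe_mkOfOrthogonalEqBot]
  exact (b i a).2

theorem exists_eigenbasis_of_isCompactOperator [CompleteSpace H] {R : H →L[𝕜] H}
    (hR : IsCompactOperator R) (hsymm : (R : H →ₗ[𝕜] H).IsSymmetric) :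
    ∃ (w : ∀ μ, Set (Module.End.eigenspace (R : Module.End 𝕜 H) μ))
      (e : HilbertBasis (Σ μ, w μ) 𝕜 H), ∀ j, R (e j) = j.1 • e j := by
  have (μ : 𝕜) : CompleteSpace (Module.End.eigenspace (R : Module.End 𝕜 H) μ) := by
    rw [Module.End.eigenspace_def]
    exact (R - μ • ContinuousLinearMap.id 𝕜 H).completeSpace_ker
  obtain ⟨w, e, he⟩ := exists_hilbertBasis_of_orthogonalFamily
    hsymm.orthogonalFamily_eigenspaces
    (ContinuousLinearMap.orthogonalComplement_iSup_eigenspaces_eq_bot hR hsymm)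
  exact ⟨w, e, fun j => Module.End.mem_eigenspace_iff.1 (he j.1 j.2)⟩

end HilbertSchmidt

section Spectrum

variable {A : RealL2 →ₗ.[ℝ] RealL2} {R : RealL2 →L[ℝ] RealL2}

theorem mem_spectrumOf_of_apply_eq_smul {ξ : A.domain} {z : ℝ} (hξ : ξ ≠ 0)
    (h : A ξ = z • (ξ : RealL2)) : z ∈ spectrumOf A := by
  rintro ⟨Q, hQ⟩
  have := hQ.left_inv ξ
  rw [h, sub_self, map_zero] at this
  exact hξ (Subtype.ext this.symm)

theorem IsResolventAt.apply_mk (hR : IsResolventAt A 0 R) (x : RealL2) :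
    A ⟨R x, hR.mem_domain x⟩ = x := by
  simpa only [zero_smul, sub_zero] using hR.right_inv x

theorem IsResolventAt.isSymmetric (hA : IsSelfAdjoint A) (hR : IsResolventAt A 0 R) :
    (R : RealL2 →ₗ[ℝ] RealL2).IsSymmetric := by
  intro x y
  have hformal := LinearPMap.adjoint_isFormalAdjoint hA.dense_domain
  rw [LinearPMap.isSelfAdjoint_def.1 hA] at hformal
  have := hformal ⟨R x, hR.mem_domain x⟩ ⟨R y, hR.mem_domain y⟩
  rw [hR.apply_mk, hR.apply_mk] at this
  exact this.symm

theorem IsResolventAt.exists_apply_eq_inv_smul (hR : IsResolventAt A 0 R) {x : RealL2} {μ : ℝ}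
    (hx : x ≠ 0) (h : R x = μ • x) : ∃ hmem : x ∈ A.domain, A ⟨x, hmem⟩ = μ⁻¹ • x := by
  have hμ : μ ≠ 0 := by
    rintro rfl
    have hzero : (⟨R x, hR.mem_domain x⟩ : A.domain) = 0 := by
      exact Subtype.ext (h.trans (zero_smul ℝ x))
    exact hx (by rw [← hR.apply_mk x, hzero, A.map_zero])
  have hRx : R (μ⁻¹ • x) = x := by rw [map_smul, h, inv_smul_smul₀ hμ]
  have hmem : x ∈ A.domain := hRx ▸ hR.mem_domain _
  have hval : (⟨x, hmem⟩ : A.domain) = ⟨R (μ⁻¹ • x), hR.mem_domain _⟩ := Subtype.ext hRx.symm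
  exact ⟨hmem, by rw [hval, hR.apply_mk]⟩

theorem IsWhiteNoiseOperator.nonempty_eigenbasis (hA : IsWhiteNoiseOperator A) :
    Nonempty (Eigenbasis A) := by
  obtain ⟨R, hR, b, hb⟩ := hA.hilbertSchmidt_inverse
  obtain ⟨c, hc, hspec⟩ := hA.one_lt_inf_spectrum
  have hsymm := hR.isSymmetric hA.selfAdjoint
  obtain ⟨w, e, he⟩ := exists_eigenbasis_of_isCompactOperator
    (isCompactOperator_of_summable_norm_apply_sq b hb) hsymm
  have e_ne_zero (j : Σ μ, w μ) : e j ≠ 0 := e.orthonormal.ne_zero j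
  choose hmem happly using fun j => hR.exists_apply_eq_inv_smul (e_ne_zero j) (he j)
  have hadjoint : R.adjoint = R :=
    ContinuousLinearMap.isSelfAdjoint_iff_isSymmetric.2 hsymm
  have hsum : Summable fun j : Σ μ, w μ => (j.1⁻¹ ^ 2)⁻¹ := by
    refine (summable_norm_adjoint_apply_sq b e hb).congr fun j => ?_
    rw [hadjoint, he, norm_smul, e.orthonormal.1 j, mul_one, inv_pow, inv_inv, Real.norm_eq_abs,
      sq_abs]
  exact ⟨⟨_, e, fun j : Σ μ, w μ => j.1⁻¹, hmem, happly, ⟨c, hc, fun j => hspec _ <|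
    mem_spectrumOf_of_apply_eq_smul (Subtype.coe_ne_coe.1 (e_ne_zero j)) (happly j)⟩, hsum⟩⟩

end Spectrum

end WhiteNoise

end

theorem mainTheorem8_general {A : RealL2 →ₗ.[ℝ] RealL2} (S : Eigenbasis A) :
    (∀ (r : ℕ), 1 ≤ r → ∀ κ : S.Dual r,
        ∀ β : ℝ, max 0 ((r : ℝ) - 2) / r ≤ β → β < 1 →
          ∃ Ξ T : S.testFunctions β →L[ℂ] S.testFunctions β,
            IsIntegralKernelOperator κ Ξ ∧ IsExp (-(1 / 2 : ℂ) • Ξ) T ∧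
            ∀ (m : ℕ) (f : S.Tensor m), IsSymm f →
              (∃! φ : S.testFunctions β, IsFunction φ fun x => pointPow x m f) ∧
              ∀ φ : S.testFunctions β, (IsFunction φ fun x => pointPow x m f) →
                IsFunction (T φ) fun x => genWick κ x m f) ∧
      (∀ (x : S.DualSpace) (m : ℕ), genWick trace x m = wick x m) ∧
      ∃ ΔG Θ : S.testFunctions 0 →L[ℂ] S.testFunctions 0,
        IsIntegralKernelOperator trace ΔG ∧ IsExp (-(1 / 2 : ℂ) • ΔG) Θ ∧
        IsRenormalization Θ ∧ (∀ Θ', IsRenormalization Θ' → Θ' = Θ) ∧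
        ∀ (m : ℕ) (f : S.Tensor m), IsSymm f →
          ∀ φ : S.testFunctions 0, (IsFunction φ fun x => pointPow x m f) →
            IsFunction (Θ φ) fun x => wick x m f := by
  refine ⟨fun r hr κ β hβ hβ' => ?_, genWick_trace, ?_⟩
  · have h := isAdmissible_of_max_div_le hr hβ hβ'
    exact ⟨integralKernelOperator h κ, expKernel h (-(1 / 2 : ℂ) • κ),
      isIntegralKernelOperator h κ, isExp_smul_expKernel_smul h _ κ, fun m f hf =>
        ⟨existsUnique_isFunction_pointPow h.nonneg h.lt_one hf,
          fun φ => isFunction_expKernel_of_pointPow h κ hf⟩⟩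
  · have h := isAdmissible_two le_rfl one_pos
    refine ⟨integralKernelOperator h trace, S.renormalization le_rfl one_pos,
      isIntegralKernelOperator h trace, isExp_smul_expKernel_smul h _ trace,
      isRenormalization_iff.2 rfl, fun Θ' => isRenormalization_iff.1, fun m f hf φ hφ => ?_⟩
    simpa only [genWick_trace, coe_renormalization] using
      isFunction_expKernel_of_pointPow h trace hf hφ

theorem mainTheorem8 (A : RealL2 →ₗ.[ℝ] RealL2) (hA : IsWhiteNoiseOperator A) :
    Nonempty (Eigenbasis A) ∧ ∀ S : Eigenbasis A,
      (∀ (r : ℕ), 1 ≤ r → ∀ κ : S.Dual r, IsSymmDual κ →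
        ∀ β : ℝ, max 0 ((r : ℝ) - 2) / r ≤ β → β < 1 →
          ∃ Ξ T : S.testFunctions β →L[ℂ] S.testFunctions β,
            IsIntegralKernelOperator κ Ξ ∧ IsExp (-(1 / 2 : ℂ) • Ξ) T ∧
            ∀ (m : ℕ) (f : S.Tensor m), IsSymm f →
              (∃! φ : S.testFunctions β, IsFunction φ fun x => pointPow x m f) ∧
              ∀ φ : S.testFunctions β, (IsFunction φ fun x => pointPow x m f) →
                IsFunction (T φ) fun x => genWick κ x m f) ∧
      (∀ (x : S.DualSpace) (m : ℕ), genWick trace x m = wick x m) ∧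
      ∃ ΔG Θ : S.testFunctions 0 →L[ℂ] S.testFunctions 0,
        IsIntegralKernelOperator trace ΔG ∧ IsExp (-(1 / 2 : ℂ) • ΔG) Θ ∧
        IsRenormalization Θ ∧ (∀ Θ', IsRenormalization Θ' → Θ' = Θ) ∧
        ∀ (m : ℕ) (f : S.Tensor m), IsSymm f →
          ∀ φ : S.testFunctions 0, (IsFunction φ fun x => pointPow x m f) →
            IsFunction (Θ φ) fun x => wick x m f :=
  ⟨hA.nonempty_eigenbasis, fun S =>
    ⟨fun r hr κ _ => (mainTheorem8_general S).1 r hr κ, (mainTheorem8_general S).2⟩⟩
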